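/- **Setting.** Let $\lambda_1,\dots,\lambda_8$ be the Gell-Mann matrices. Equip $\mathfrak{su}(3)$ (traceless anti-Hermitian complex $3\times3$ matrices) with $\langle X|Y\rangle=\operatorname{tr}(X^\dagger Y)$, the orthonormal basis $E_j=\tfrac{i}{\sqrt2}\lambda_j$, coordinates $x_j=\langle E_j|X\rangle$ and structure constants $[E_j,E_k]=\sum_l c^l_{jk}E_l$. For an $\mathrm{Ad}$-invariant set $S\subset\mathfrak{su}(3)$, $Poly(S)$ is the algebra of restrictions to $S$ of complex polynomials in $x_1,\dots,x_8$; on it, $\{f,g\}$ is the restriction to $S$ of $\sum_{j,k,l}c^l_{kj}\,x_l\,\partial_jF\,\partial_kG$ for any polynomials $F,G$ extending $f,g$. Let $\mathcal S^7$ be the unit sphere of $\mathfrak{su}(3)$, and put $\varpi_1=\tfrac1{\sqrt2}E_3+\tfrac1{\sqrt6}E_8$, $\varpi_2=\sqrt{2/3}\,E_8$. Dominant weights are the points $p\varpi_1+q\varpi_2$ with $p,q\in\mathbb N_0$. The adjoint orbits in $\mathcal S^7$ are the orbits $\mathcal O_\xi$ of the points $\xi=a\varpi_1+b\varpi_2\in\mathcal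 S^7$ with $a,b\ge0$; $\mathcal O_\xi$ is *rational* if a positive rescaling maps it onto the orbit of a dominant weight. Let $\overline{\mathcal Q}$ be the set of the points $\xi$ of rational orbits. For $\xi\in\overline{\mathcal Q}$ let $r(\xi)=\min\{R>0: R\xi \text{ is a dominant weight}\}$ and $\omega_\xi=r(\xi)\xi$. **Rays.** Let $\mathcal H_\omega$ be the finite-dimensional Hilbert space of the irreducible unitary representation $\rho$ of $SU(3)$ with highest weight $\omega$. A *symbol correspondence* $W:\mathcal B(\mathcal H_\omega)\to Poly(\mathcal O_\xi)$ is an injective linear map with $W_{\rho(g)A\rho(g)^{-1}}(x)=W_A(\mathrm{Ad}_{g^{-1}}x)$, $W_{A^\dagger}=\overline{W_A}$, and $\int_{\mathcal O_\xi}W_A=\operatorname{tr}(A)/\dim\mathcal H_\omega$ for the invariant probability measure on $\mathcal O_\xi$. A *universal correspondence* for $\omega$ is the composition of the induced representation $U(\mathfrak{sl}(3))\to\mathcal B(\mathcal H_\omega)$ with a symbol correspondence. A *$\xi$-ray* is a sequence $(w^s_\xi)_{s\in\mathbb N}$, $s\geq1$, of universal correspondences $w^s_\xi:U(\mathfrak{sl}(3))\to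 Poly(\mathcal O_\xi)$ for the weights $s\,\omega_\xi$. Its twisted product on the image of $w^s_\xi$ is $w^s_\xi[u]\star^s_\xi w^s_\xi[v]=w^s_\xi[uv]$, with commutator $[\cdot,\cdot]_{\star^s_\xi}$. The ray is *of Poisson type* if any $f_1,f_2\in Poly(\mathcal O_\xi)$ lie in the image of $w^s_\xi$ for all large $s$ and, uniformly on $\mathcal O_\xi$ as $s\to\infty$, $$f_1\star^s_\xi f_2\to f_1f_2,\qquad s\,r(\xi)\,[f_1,f_2]_{\star^s_\xi}\to i\{f_1,f_2\}.$$ **Gluing.** Let $$\begin{aligned}\tau={}&6(x_1^2+x_2^2+x_3^2)x_8-2x_8^3+6\sqrt3\,\big(x_1(x_4x_6+x_5x_7)-x_2(x_4x_7-x_5x_6)\big)\\&-3(x_4^2+x_5^2+x_6^2+x_7^2)x_8+3\sqrt3\,x_3(x_4^2+x_5^2-x_6^2-x_7^2),\end{aligned}$$ an invariant polynomial that separates the orbits in $\mathcal S^7$, and let $\check\tau_\xi=\tau|_{\mathcal S^7}-\tau(\xi)$. For a finite $\mathcal P\subset\overline{\mathcal Q}$ let $I_{\mathcal P}\subset Poly(\mathcal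 S^7)$ be the ideal of polynomials vanishing on $\bigcup_{\xi\in\mathcal P}\mathcal O_\xi$, and for $\xi\in\mathcal P$ let $\mathfrak d^\xi_{\mathcal P}=\prod_{\xi'\in\mathcal P\setminus\{\xi\}}\check\tau_{\xi'}/\check\tau_{\xi'}(\xi)$, which is $1$ on $\mathcal O_\xi$ and $0$ on the other orbits of $\mathcal P$. Given a $\xi$-ray for each $\xi\in\mathcal P$, put $$w^s_{\mathcal P}[u]=\sum_{\xi\in\mathcal P}\mathfrak d^\xi_{\mathcal P}\,w^s_\xi[u]\ \in\ Poly(\mathcal S^7)/I_{\mathcal P}\simeq\prod_{\xi\in\mathcal P}Poly(\mathcal O_\xi),$$ and, on the image of $w^s_{\mathcal P}$, $$w^s_{\mathcal P}[u]\star^s_{\mathcal P}w^s_{\mathcal P}[v]=w^s_{\mathcal P}[uv],\qquad \big[w^s_{\mathcal P}[u],w^s_{\mathcal P}[v]\big]^r=\sum_{\xi\in\mathcal P}\mathfrak d^\xi_{\mathcal P}\,r(\xi)\,\big[w^s_\xi[u],w^s_\xi[v]\big]_{\star^s_\xi}.$$ **Magoo spheres.** A *chain* is a sequence of finite sets $\mathcal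 P_1\subsetneq\mathcal P_2\subsetneq\cdots$ with $\bigcup_n\mathcal P_n=\overline{\mathcal Q}$. A *Magoo sphere* is given by a chain and a $\xi$-ray for every $\xi\in\overline{\mathcal Q}$ (*its* $\xi$-rays); it carries the glued correspondences $w^s_n=w^s_{\mathcal P_n}:U(\mathfrak{sl}(3))\to\mathfrak P_n=Poly(\mathcal S^7)/I_{\mathcal P_n}$, with products $\star^s_n$ and brackets $[\cdot,\cdot]^r$. It is *of Poisson type* if for all $f_1,f_2\in Poly(\mathcal S^7)$ the classes of $f_1,f_2$ in $\mathfrak P_n$ lie, for each $n$ and all large $s$, in the image of $w^s_n$, and $$\lim_{n\to\infty}\lim_{s\to\infty}f_1\star^s_nf_2=f_1f_2,\qquad\lim_{n\to\infty}\lim_{s\to\infty}s\,[f_1,f_2]^r=i\{f_1,f_2\}.$$ Here the limit $s\to\infty$ is taken first, in $\mathfrak P_n$, and means convergence in supremum norm of the components on $\mathcal O_\xi$, uniformly over $\xi\in\mathcal P_n$; and $\lim_{n\to\infty}h_n=h$, for $h_n\in\mathfrak P_n$ and $h\in\prod_{\xi\in\overline{\mathcal Q}}Poly(\mathcal O_\xi)\supset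 Poly(\mathcal S^7)$, means that for every $n$ the components of $h_n$ are those of $h$ on the orbits of $\mathcal P_n$. **Theorem.** A Magoo sphere is of Poisson type if and only if all of its $\xi$-rays, $\xi\in\overline{\mathcal Q}$, are of Poisson type. In particular, the property does not depend on the chain: of two Magoo spheres with the same $\xi$-rays and arbitrary chains, one is of Poisson type if and only if the other is. -/

import Mathlib

open scoped Matrix ENNReal Topology
open Filter

namespace Magoo

noncomputable section

attribute [local instance] LieRing.ofAssociativeRing

/-! ### The Lie algebra `su(3)` and its polynomial functions -/

/-- Complex `3 × 3` matrices. -/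
abbrev Mat := Matrix (Fin 3) (Fin 3) ℂ

/-- The group `SU(3)`. -/
abbrev SU3 := Matrix.specialUnitaryGroup (Fin 3) ℂ

/-- The Lie algebra `su(3)`, as a set of matrices. -/
def su3 : Set Mat := {X | Xᴴ = -X ∧ X.trace = 0}

/-- The Gell-Mann matrices `λ₁, …, λ₈` (indexed from `0`). -/
def gellMann (j : Fin 8) : Mat :=
  match j with
  | 0 => !![0, 1, 0; 1, 0, 0; 0, 0, 0]
  | 1 => !![0, -Complex.I, 0; Complex.I, 0, 0; 0, 0, 0]
  | 2 => !![1, 0, 0; 0, -1, 0; 0, 0, 0]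
  | 3 => !![0, 0, 1; 0, 0, 0; 1, 0, 0]
  | 4 => !![0, 0, -Complex.I; 0, 0, 0; Complex.I, 0, 0]
  | 5 => !![0, 0, 0; 0, 0, 1; 0, 1, 0]
  | 6 => !![0, 0, 0; 0, 0, -Complex.I; 0, Complex.I, 0]
  | 7 => ((1 / Real.sqrt 3 : ℝ) : ℂ) • !![1, 0, 0; 0, 1, 0; 0, 0, -2]

/-- The basis `E_j = i λ_j / √2` of `su(3)`, orthonormal for `⟨X | Y⟩ = tr (X† Y)`. -/
def basisE (j : Fin 8) : Mat := (Complex.I / (Real.sqrt 2 : ℂ)) • gellMann j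

/-- The coordinates `x_j = ⟨E_j | X⟩` with respect to the basis `E_j` (real numbers on `su(3)`). -/
def coord (j : Fin 8) (X : Mat) : ℂ := ((basisE j)ᴴ * X).trace

/-- The structure constant `c^l_{jk}`, defined by `[E_j, E_k] = ∑_l c^l_{jk} E_l`. -/
def structConst (j k l : Fin 8) : ℂ :=
  ((basisE l)ᴴ * (basisE j * basisE k - basisE k * basisE j)).trace

/-- `Poly(su(3))`: complex polynomials in the eight coordinates `x_j`. -/
abbrev PolyAlg := MvPolynomial (Fin 8) ℂ

/-- The value of a polynomial at a matrix. -/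
def evalAt (X : Mat) : PolyAlg →ₐ[ℂ] ℂ := MvPolynomial.aeval (fun j => coord j X)

/-- The Poisson bracket of the KAKS bivector `∑ c^l_{kj} x_l ∂_j ⊗ ∂_k` on `Poly(su(3))`. -/
def bracket (F G : PolyAlg) : PolyAlg :=
  ∑ j, ∑ k, ∑ l, MvPolynomial.C (structConst k j l) * MvPolynomial.X l *
    MvPolynomial.pderiv j F * MvPolynomial.pderiv k G

/-- Restriction of polynomials on `su(3)` to a set of matrices. -/
def restr (S : Set Mat) : PolyAlg →ₐ[ℂ] (S → ℂ) := AlgHom.pi fun x => evalAt x.1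

/-- `Poly(S)`: the algebra of functions on `S` that are restrictions of polynomials. -/
def Poly (S : Set Mat) : Subalgebra ℂ (S → ℂ) := (restr S).range

/-- The restriction of a polynomial to `S`, as an element of `Poly(S)`. -/
def toPoly (S : Set Mat) (F : PolyAlg) : Poly S := ⟨restr S F, F, rfl⟩

/-- A polynomial on `su(3)` extending `f ∈ Poly(S)`. -/
def extend {S : Set Mat} (f : Poly S) : PolyAlg := f.2.choose

theorem toPoly_extend {S : Set Mat} (f : Poly S) : toPoly S (extend f) = f :=
  Subtype.ext f.2.choose_spec

/-- The Poisson bracket induced on `Poly(S)` by restricting the KAKS bivector to `S`, for `S` a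
union of (co)adjoint orbits: restrict the bracket of any two polynomial extensions
(`poisson_toPoly` shows that the extensions do not matter). -/
def poisson {S : Set Mat} (f g : Poly S) : Poly S := toPoly S (bracket (extend f) (extend g))

/-- Restriction of functions `Poly(S) → Poly(T)` for `T ⊆ S`. -/
def restrict {S T : Set Mat} (h : T ⊆ S) : Poly S →ₐ[ℂ] Poly T :=
  AlgHom.codRestrict
    (AlgHom.pi fun x : T => (Pi.evalAlgHom ℂ (fun _ : S => ℂ) (Set.inclusion h x)).comp (Poly S).val)
    (Poly T) (by rintro ⟨_, F, rfl⟩; exact ⟨F, rfl⟩)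

/-- The supremum norm of a function, with values in `[0, ∞]`. -/
def supNorm {S : Set Mat} (f : Poly S) : ℝ≥0∞ := ⨆ x : S, ‖f.1 x‖ₑ

/-! ### Adjoint orbits, the unit sphere, rational orbits -/

/-- The adjoint action of `SU(3)`. -/
def Ad (g : SU3) (X : Mat) : Mat := (g : Mat) * X * ((g⁻¹ : SU3) : Mat)

/-- The adjoint orbit of a matrix. -/
def orbit (X : Mat) : Set Mat := Set.range fun g : SU3 => Ad g X

/-- The unit sphere `𝒮⁷ ⊂ su(3)`. -/
def S7 : Set Mat := {X | X ∈ su3 ∧ (Xᴴ * X).trace = 1}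

/-- The fundamental weight `ϖ₁ = E₃/√2 + E₈/√6`. -/
def fundWeight₁ : Mat := ((1 / Real.sqrt 2 : ℝ) : ℂ) • basisE 2 + ((1 / Real.sqrt 6 : ℝ) : ℂ) • basisE 7

/-- The fundamental weight `ϖ₂ = √(2/3) E₈`. -/
def fundWeight₂ : Mat := ((Real.sqrt (2 / 3) : ℝ) : ℂ) • basisE 7

/-- The point `a ϖ₁ + b ϖ₂`. -/
def weight (a b : ℝ) : Mat := (a : ℂ) • fundWeight₁ + (b : ℂ) • fundWeight₂

/-- Dominant weights `p ϖ₁ + q ϖ₂`, `p, q ∈ ℕ₀`. -/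
def IsDominantWeight (ω : Mat) : Prop := ∃ p q : ℕ, ω = weight p q

/-- `ℱ̄`: the intersection of the unit sphere with the closed principal Weyl chamber. It
parametrizes the adjoint orbits in `𝒮⁷`. -/
def Fbar : Set Mat := {ξ | ξ ∈ S7 ∧ ∃ a b : ℝ, 0 ≤ a ∧ 0 ≤ b ∧ ξ = weight a b}

/-- The orbit of `ξ` is equivalent, by a positive rescaling, to the orbit of a dominant weight. -/
def IsRational (ξ : Mat) : Prop :=
  ∃ ω, IsDominantWeight ω ∧ ∃ α : ℝ, 0 < α ∧ (fun v : Mat => (α : ℂ) • v) '' orbit ξ = orbit ω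

/-- `𝒬̄`: the set of rational orbits, each represented by its point `ξ ∈ ℱ̄`. -/
structure RatOrbit where
  pt : Mat
  mem_Fbar : pt ∈ Fbar
  rational : IsRational pt

/-- The orbit `𝒪_ξ ⊂ 𝒮⁷`. -/
def RatOrbit.orb (ξ : RatOrbit) : Set Mat := orbit ξ.pt

/-- The integral radius `r(ξ) = min {R > 0 : R ξ is a dominant weight}`. -/
def intRadius (ξ : RatOrbit) : ℝ := sInf {R : ℝ | 0 < R ∧ IsDominantWeight ((R : ℂ) • ξ.pt)}

/-- The first dominant weight `ω_ξ = r(ξ) ξ`. -/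
def firstWeight (ξ : RatOrbit) : Mat := (intRadius ξ : ℂ) • ξ.pt

theorem ad_mem_S7 (g : SU3) {X : Mat} (hX : X ∈ S7) : Ad g X ∈ S7 := by
  obtain ⟨⟨h1, h2⟩, h3⟩ := hX
  have hg : (((g⁻¹ : SU3) : Mat)) = (g : Mat)ᴴ := rfl
  have hu : (g : Mat)ᴴ * (g : Mat) = 1 := by
    have := (Matrix.mem_specialUnitaryGroup_iff.1 g.2).1
    exact Matrix.mem_unitaryGroup_iff'.1 this
  refine ⟨⟨?_, ?_⟩, ?_⟩
  · simp [Ad, hg, h1, Matrix.conjTranspose_mul, Matrix.mul_assoc]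
  · rw [Ad, hg, Matrix.trace_mul_cycle, hu, Matrix.one_mul, h2]
  · have : (Ad g X)ᴴ * Ad g X = (g : Mat) * (Xᴴ * X) * (g : Mat)ᴴ := by
      simp only [Ad, hg, Matrix.conjTranspose_mul, Matrix.conjTranspose_conjTranspose]
      calc (g : Mat) * (Xᴴ * (g : Mat)ᴴ) * ((g : Mat) * X * (g : Mat)ᴴ)
          = (g : Mat) * Xᴴ * ((g : Mat)ᴴ * (g : Mat)) * X * (g : Mat)ᴴ := by
            simp only [Matrix.mul_assoc]
        _ = _ := by rw [hu]; simp only [Matrix.mul_assoc, Matrix.one_mul]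
    rw [this, Matrix.trace_mul_cycle, hu, Matrix.one_mul, h3]

theorem RatOrbit.orb_subset (ξ : RatOrbit) : ξ.orb ⊆ S7 := by
  rintro _ ⟨g, rfl⟩
  exact ad_mem_S7 g ξ.mem_Fbar.1

/-- The restriction map `Poly(𝒮⁷) → Poly(𝒪_ξ)`. -/
def toOrbit (ξ : RatOrbit) : Poly S7 →ₐ[ℂ] Poly ξ.orb := restrict ξ.orb_subset

theorem toOrbit_surjective (ξ : RatOrbit) : Function.Surjective (toOrbit ξ) := by
  rintro ⟨_, F, rfl⟩
  exact ⟨toPoly S7 F, rfl⟩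

/-! ### Haar measure of `SU(3)` -/

instance : IsTopologicalGroup SU3 where
  continuous_inv := by
    refine Continuous.subtype_mk ?_ _
    exact (continuous_subtype_val (p := fun x : Mat => x ∈ SU3)).matrix_conjTranspose

instance : CompactSpace SU3 := by
  refine (isCompact_iff_compactSpace (s := (SU3 : Set Mat))).1 ?_
  have hK : IsCompact (Set.pi Set.univ fun _ : Fin 3 =>
      Set.pi Set.univ fun _ : Fin 3 => Metric.closedBall (0 : ℂ) 1) :=
    isCompact_univ_pi fun _ => isCompact_univ_pi fun _ => isCompact_closedBall _ _
  refine hK.of_isClosed_subset ?_ ?_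
  · have : (SU3 : Set Mat) = {A : Mat | A * Aᴴ = 1} ∩ {A : Mat | A.det = 1} := by
      ext A
      simp only [SetLike.mem_coe, Matrix.mem_specialUnitaryGroup_iff, Matrix.mem_unitaryGroup_iff]
      rfl
    rw [this]
    refine IsClosed.inter (isClosed_eq ?_ continuous_const) (isClosed_eq ?_ continuous_const)
    · exact continuous_id.matrix_mul continuous_id.matrix_conjTranspose
    · exact continuous_id.matrix_det
  · intro A hA
    simp only [Set.mem_pi, Metric.mem_closedBall, dist_zero_right]
    exact fun i _ j _ => entry_norm_bound_of_unitary (Matrix.mem_specialUnitaryGroup_iff.1 hA).1 i j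

instance : MeasurableSpace SU3 := borel _

instance : BorelSpace SU3 := ⟨rfl⟩

/-- The normalized Haar measure of `SU(3)`. -/
def haarSU3 : MeasureTheory.Measure SU3 := MeasureTheory.Measure.haarMeasure ⊤

/-! ### Quantum quark systems and universal correspondences -/

/-- The complex Lie algebra `sl(3)`. -/
abbrev sl3 := LieAlgebra.SpecialLinear.sl (Fin 3) ℂ

/-- The universal enveloping algebra `U(sl(3))`. -/
abbrev Usl3 := UniversalEnvelopingAlgebra ℂ sl3

/-- A quantum quark system with highest weight `ω`: an irreducible unitary representation `ρ` of
`SU(3)` on some `ℂᵈ`, with its infinitesimal representation `dρ` of `sl(3)` (determined by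
`ρ (exp X) = exp (dρ X)` for `X ∈ su(3)`, and complex linearity), such that the highest weight
is `ω`, i.e. some nonzero vector is annihilated by all strictly upper triangular matrices and is
an eigenvector of each diagonal `H`, of eigenvalue `tr (H (-i ω))`. Since `SU(3)` is connected,
a subspace is invariant under `ρ` if and only if it is invariant under `dρ`. -/
structure QuarkSystem (ω : Mat) where
  dim : ℕ
  ρ : SU3 →* Matrix.unitaryGroup (Fin dim) ℂ
  continuous_ρ : Continuous ρ
  dρ : sl3 →ₗ⁅ℂ⁆ Matrix (Fin dim) (Fin dim) ℂ
  ρ_exp : ∀ (X : sl3) (g : SU3), X.1 ∈ su3 → (g : Mat) = NormedSpace.exp X.1 →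
    (ρ g : Matrix (Fin dim) (Fin dim) ℂ) = NormedSpace.exp (dρ X)
  irreducible : ∀ V : Submodule ℂ (Fin dim → ℂ),
    (∀ (X : sl3), ∀ v ∈ V, dρ X *ᵥ v ∈ V) → V = ⊥ ∨ V = ⊤
  highest_weight : ∃ v : Fin dim → ℂ, v ≠ 0 ∧
    (∀ X : sl3, (∀ i j : Fin 3, j ≤ i → X.1 i j = 0) → dρ X *ᵥ v = 0) ∧
    (∀ H : sl3, (∀ i j : Fin 3, i ≠ j → H.1 i j = 0) →
      dρ H *ᵥ v = (H.1 * (-Complex.I • ω)).trace • v)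

/-- The operators on the Hilbert space of a quark system. -/
abbrev QuarkSystem.Op {ω : Mat} (Q : QuarkSystem ω) := Matrix (Fin Q.dim) (Fin Q.dim) ℂ

/-- The representation of `U(sl(3))` on the Hilbert space of a quark system. -/
def QuarkSystem.rep {ω : Mat} (Q : QuarkSystem ω) : Usl3 →ₐ[ℂ] Q.Op :=
  UniversalEnvelopingAlgebra.lift ℂ Q.dρ

/-- A symbol correspondence `ℬ(ℋ_ω) → Poly(𝒪_ξ)`: a linear injection which is `SU(3)`-equivariant,
real, and normalized with respect to the invariant integral on the orbit. -/
structure IsSymbolCorrespondence {ω : Mat} (Q : QuarkSystem ω) (ξ : RatOrbit)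
    (W : Q.Op →ₗ[ℂ] Poly ξ.orb) : Prop where
  injective : Function.Injective W
  equivariant : ∀ (g : SU3) (A : Q.Op) (x y : ξ.orb), y.1 = Ad g⁻¹ x.1 →
    (W ((Q.ρ g : Q.Op) * A * (Q.ρ g⁻¹ : Q.Op))).1 x = (W A).1 y
  real : ∀ (A : Q.Op) (x : ξ.orb), (W Aᴴ).1 x = star ((W A).1 x)
  normalized : ∀ A : Q.Op,
    ∫ g : SU3, (W A).1 ⟨Ad g ξ.pt, g, rfl⟩ ∂haarSU3 = A.trace / (Q.dim : ℂ)

/-- A universal correspondence for the weight `ω`: a map `U(sl(3)) → Poly(𝒪_ξ)` that factors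
through the irreducible representation with highest weight `ω` and a symbol correspondence. -/
def IsUniversalCorrespondence (ξ : RatOrbit) (ω : Mat) (w : Usl3 →ₗ[ℂ] Poly ξ.orb) : Prop :=
  ∃ (Q : QuarkSystem ω) (W : Q.Op →ₗ[ℂ] Poly ξ.orb), IsSymbolCorrespondence Q ξ W ∧
    w = W ∘ₗ Q.rep.toLinearMap

/-- A `ξ`-ray of universal correspondences `(w^s_ξ)`, `s = 1, 2, …`, where `w^s_ξ` is a universal
correspondence for the weight `s ω_ξ`. -/
structure Ray (ξ : RatOrbit) where
  w : ℕ+ → (Usl3 →ₗ[ℂ] Poly ξ.orb)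
  universal : ∀ s : ℕ+, IsUniversalCorrespondence ξ (((s : ℕ) : ℂ) • firstWeight ξ) (w s)

/-- The twisted product induced on the image of a linear map `w` on `U(sl(3))`:
`w[u] ⋆ w[v] = w[uv]`. It is meant for maps whose kernel is a two-sided ideal and for `f`, `g` in
the image of `w`; see `Ray.twisted_apply`, `twisted_glued`. -/
def twisted {V : Type} [AddCommGroup V] [Module ℂ V] (w : Usl3 →ₗ[ℂ] V) (f g : V) : V :=
  w (Function.invFun w f * Function.invFun w g)

/-- The commutator of the twisted product. -/
def twistedComm {V : Type} [AddCommGroup V] [Module ℂ V] (w : Usl3 →ₗ[ℂ] V) (f g : V) : V :=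
  twisted w f g - twisted w g f

/-- A `ξ`-ray is of Poisson type: any `f₁, f₂ ∈ Poly(𝒪_ξ)` lie in the image of `w^s_ξ` for large
`s`, so that `f₁ ⋆ f₂` makes sense, and, uniformly on `𝒪_ξ` as `s → ∞`,
`f₁ ⋆ f₂ → f₁ f₂` and `s r(ξ) [f₁, f₂]_⋆ → i {f₁, f₂}`. -/
def Ray.IsPoisson {ξ : RatOrbit} (R : Ray ξ) : Prop :=
  ∀ f₁ f₂ : Poly ξ.orb,
    (∀ᶠ s in atTop, f₁ ∈ LinearMap.range (R.w s) ∧ f₂ ∈ LinearMap.range (R.w s)) ∧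
    Tendsto (fun s => supNorm (twisted (R.w s) f₁ f₂ - f₁ * f₂)) atTop (𝓝 0) ∧
    Tendsto (fun s : ℕ+ => supNorm ((((s : ℕ) : ℂ) * (intRadius ξ : ℂ)) • twistedComm (R.w s) f₁ f₂
      - Complex.I • poisson f₁ f₂)) atTop (𝓝 0)

/-! ### Gluing over a finite set of rational orbits -/

/-- The invariant cubic polynomial `τ`, which separates the orbits in `𝒮⁷`. -/
def tau : PolyAlg :=
  let x : Fin 8 → PolyAlg := MvPolynomial.X
  let c : ℝ → PolyAlg := fun t => MvPolynomial.C (t : ℂ)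
  6 * (x 0 ^ 2 + x 1 ^ 2 + x 2 ^ 2) * x 7 - 2 * x 7 ^ 3
    + c (6 * Real.sqrt 3) * (x 0 * (x 3 * x 5 + x 4 * x 6) - x 1 * (x 3 * x 6 - x 4 * x 5))
    - 3 * (x 3 ^ 2 + x 4 ^ 2 + x 5 ^ 2 + x 6 ^ 2) * x 7
    + c (3 * Real.sqrt 3) * x 2 * (x 3 ^ 2 + x 4 ^ 2 - x 5 ^ 2 - x 6 ^ 2)

/-- `τ̌_ξ = τ|_{𝒮⁷} - τ(ξ)`, vanishing on `𝒪_ξ` and on no other orbit of `𝒮⁷`. -/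
def tauCheck (ξ : RatOrbit) : Poly S7 := toPoly S7 tau - algebraMap ℂ (Poly S7) (evalAt ξ.pt tau)

open Classical in
/-- The polynomial `𝔡^ξ_𝒫 = ∏ τ̌_ξ' / ∏ τ̌_ξ'(ξ)` (products over `ξ' ∈ 𝒫 ∖ {ξ}`), equal to `1` on
`𝒪_ξ` and to `0` on the other orbits of `𝒫`. -/
def delta (P : Finset RatOrbit) (ξ : RatOrbit) : Poly S7 :=
  (∏ ξ' ∈ P.erase ξ, (tauCheck ξ').1 ⟨ξ.pt, ξ.mem_Fbar.1⟩)⁻¹ • ∏ ξ' ∈ P.erase ξ, tauCheck ξ'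

/-- The ideal `I_𝒫 ⊂ Poly(𝒮⁷)` of polynomials vanishing on the orbits of `𝒫`. -/
def vanishing (P : Finset RatOrbit) : Ideal (Poly S7) := ⨅ ξ ∈ P, RingHom.ker (toOrbit ξ)

/-- `Poly(𝒮⁷) / I_𝒫 ≃ ∏_{ξ ∈ 𝒫} Poly(𝒪_ξ)`. -/
abbrev PolyOver (P : Finset RatOrbit) : Type := Poly S7 ⧸ vanishing P

/-- The class of a polynomial in `Poly(𝒮⁷) / I_𝒫`. -/
def cls (P : Finset RatOrbit) : Poly S7 →ₐ[ℂ] PolyOver P := Ideal.Quotient.mkₐ ℂ (vanishing P)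

/-- The `ξ`-component `Poly(𝒮⁷) / I_𝒫 → Poly(𝒪_ξ)`, for `ξ ∈ 𝒫`. -/
def component {P : Finset RatOrbit} {ξ : RatOrbit} (hξ : ξ ∈ P) : PolyOver P →ₐ[ℂ] Poly ξ.orb :=
  Ideal.Quotient.liftₐ (vanishing P) (toOrbit ξ) fun _ ha =>
    (Ideal.mem_iInf.1 ((Ideal.mem_iInf.1 ha) ξ)) hξ

/-- A linear choice of representatives for `Poly(𝒪_ξ) ≃ Poly(𝒮⁷) / I_ξ`. -/
def lift (ξ : RatOrbit) : Poly ξ.orb →ₗ[ℂ] Poly S7 :=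
  (LinearMap.exists_rightInverse_of_surjective (toOrbit ξ).toLinearMap
    (LinearMap.range_eq_top.2 (toOrbit_surjective ξ))).choose

theorem toOrbit_lift (ξ : RatOrbit) (f : Poly ξ.orb) : toOrbit ξ (lift ξ f) = f :=
  LinearMap.congr_fun (LinearMap.exists_rightInverse_of_surjective (toOrbit ξ).toLinearMap
    (LinearMap.range_eq_top.2 (toOrbit_surjective ξ))).choose_spec f

/-- The map `f ↦ 𝔡^ξ_𝒫 f` from `Poly(𝒪_ξ) ≃ Poly(𝒮⁷) / I_ξ` to `Poly(𝒮⁷) / I_𝒫`, for `ξ ∈ 𝒫`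
(independent of the representatives, see `deltaMul_toOrbit`). -/
def deltaMul (P : Finset RatOrbit) (ξ : RatOrbit) : Poly ξ.orb →ₗ[ℂ] PolyOver P :=
  (cls P).toLinearMap ∘ₗ LinearMap.mulLeft ℂ (delta P ξ) ∘ₗ lift ξ

/-- The glued correspondence `w^s_𝒫[u] = ∑_{ξ ∈ 𝒫} 𝔡^ξ_𝒫 w^s_ξ[u]`. -/
def glued (R : ∀ ξ : RatOrbit, Ray ξ) (P : Finset RatOrbit) (s : ℕ+) : Usl3 →ₗ[ℂ] PolyOver P :=
  ∑ ξ ∈ P, deltaMul P ξ ∘ₗ (R ξ).w s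

/-- The `r`-weighted bracket on the image of the glued correspondence:
`[w_𝒫[u], w_𝒫[v]]^r = ∑_{ξ ∈ 𝒫} 𝔡^ξ_𝒫 r(ξ) [w_ξ[u], w_ξ[v]]_⋆`. -/
def weightedBracket (R : ∀ ξ : RatOrbit, Ray ξ) (P : Finset RatOrbit) (s : ℕ+)
    (f g : PolyOver P) : PolyOver P :=
  ∑ ξ ∈ P, deltaMul P ξ ((intRadius ξ : ℂ) • twistedComm ((R ξ).w s)
    ((R ξ).w s (Function.invFun (glued R P s) f)) ((R ξ).w s (Function.invFun (glued R P s) g)))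

/-! ### Magoo spheres -/

/-- A chain `𝒫₁ ⊊ 𝒫₂ ⊊ ⋯` of finite sets of rational orbits, exhausting `𝒬̄`. -/
structure Chain where
  P : ℕ+ → Finset RatOrbit
  ssubset : ∀ n, P n ⊂ P (n + 1)
  exhausts : ∀ ξ, ∃ n, ξ ∈ P n

/-- The data defining a Magoo sphere: a chain and a `ξ`-ray of universal correspondences for each
rational orbit. -/
structure MagooSphere where
  chain : Chain
  ray : ∀ ξ : RatOrbit, Ray ξ

namespace MagooSphere

variable (𝔚 : MagooSphere)

/-- `𝔓_n = Poly(𝒮⁷) / I_{𝒫_n}`. -/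
abbrev Pn (n : ℕ+) : Type := PolyOver (𝔚.chain.P n)

/-- The Magoo pencil of correspondence rays `w_n^s : U(sl(3)) → 𝔓_n`. -/
def w (n s : ℕ+) : Usl3 →ₗ[ℂ] 𝔚.Pn n := glued 𝔚.ray (𝔚.chain.P n) s

/-- The Magoo product `⋆_n^s`. -/
def prod (n s : ℕ+) (f g : 𝔚.Pn n) : 𝔚.Pn n := twisted (𝔚.w n s) f g

/-- The Magoo bracket `[·,·]^r` for `⋆_n^s`. -/
def brack (n s : ℕ+) (f g : 𝔚.Pn n) : 𝔚.Pn n := weightedBracket 𝔚.ray (𝔚.chain.P n) s f g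

/-- Convergence in `𝔓_n` as `s → ∞`: the components converge in supremum norm, uniformly over the
orbits in `𝒫_n`. -/
def LimS (n : ℕ+) (a : ℕ+ → 𝔚.Pn n) (L : 𝔚.Pn n) : Prop :=
  ∀ ε : ℝ≥0∞, 0 < ε → ∃ s₀, ∀ s ≥ s₀, ∀ (ξ : RatOrbit) (hξ : ξ ∈ 𝔚.chain.P n),
    supNorm (component hξ (a s) - component hξ L) < ε

/-- Convergence as `n → ∞` of a sequence `h_n ∈ 𝔓_n` to `h ∈ 𝔓 = ∏_ξ Poly(𝒪_ξ)`: every `h_n` is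
the projection of `h`. -/
def LimN (h : ∀ n, 𝔚.Pn n) (H : ∀ ξ : RatOrbit, Poly ξ.orb) : Prop :=
  ∀ (n : ℕ+) (ξ : RatOrbit) (hξ : ξ ∈ 𝔚.chain.P n), component hξ (h n) = H ξ

/-- The iterated limit, `s → ∞` first and then `n → ∞`, exists and equals `H`. -/
def IterLim (a : ∀ n : ℕ+, ℕ+ → 𝔚.Pn n) (H : ∀ ξ : RatOrbit, Poly ξ.orb) : Prop :=
  ∃ L : ∀ n, 𝔚.Pn n, (∀ n, 𝔚.LimS n (a n) (L n)) ∧ 𝔚.LimN L H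

/-- A Magoo sphere is of Poisson type: for all `f₁, f₂ ∈ Poly(𝒮⁷)` and all `n`, the classes of `f₁`
and `f₂` in `𝔓_n` lie in the image of `w_n^s` for large `s`, so that the Magoo product and bracket
make sense, and the iterated limits (first `s → ∞`, then `n → ∞`) of the Magoo product and of `s`
times the Magoo bracket are `f₁ f₂` and `i {f₁, f₂}`. -/
def IsPoisson : Prop :=
  ∀ f₁ f₂ : Poly S7,
    (∀ n, ∀ᶠ s in atTop, cls (𝔚.chain.P n) f₁ ∈ LinearMap.range (𝔚.w n s) ∧
      cls (𝔚.chain.P n) f₂ ∈ LinearMap.range (𝔚.w n s)) ∧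
    𝔚.IterLim (fun n s => 𝔚.prod n s (cls _ f₁) (cls _ f₂)) (fun ξ => toOrbit ξ (f₁ * f₂)) ∧
    𝔚.IterLim (fun n s => ((s : ℕ) : ℂ) • 𝔚.brack n s (cls _ f₁) (cls _ f₂))
      (fun ξ => toOrbit ξ (Complex.I • poisson f₁ f₂))

end MagooSphere

/-! ### The definitions do not depend on the choices made in them -/

theorem conj_eq (g : SU3) : ((g⁻¹ : SU3) : Mat) = (g : Mat)ᴴ := rfl

theorem det_ad (g : SU3) (X : Mat) : (Ad g X).det = X.det := by
  have h : (g : Mat) * ((g⁻¹ : SU3) : Mat) = 1 := by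
    rw [← Submonoid.coe_mul, mul_inv_cancel]; rfl
  rw [Ad, Matrix.det_mul_right_comm, h, Matrix.one_mul]

theorem trace_ad (g : SU3) (X : Mat) : (Ad g X).trace = X.trace := by
  have h : ((g⁻¹ : SU3) : Mat) * (g : Mat) = 1 := by
    rw [← Submonoid.coe_mul, inv_mul_cancel]; rfl
  rw [Ad, Matrix.trace_mul_cycle, h, Matrix.one_mul]

theorem conj_gellMann (j : Fin 8) : (gellMann j)ᴴ = gellMann j := by
  fin_cases j <;> ext a b <;> fin_cases a <;> fin_cases b <;>
    simp [gellMann, Matrix.conjTranspose_apply]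

theorem conj_basisE (j : Fin 8) : (basisE j)ᴴ = -basisE j := by
  rw [basisE, Matrix.conjTranspose_smul, conj_gellMann, ← neg_smul]
  congr 1
  simp [neg_div]

theorem coord_eq (X : Mat) (hX : X.trace = 0) (j : Fin 8) :
    coord j X = -(Complex.I / ((Real.sqrt 2 : ℝ) : ℂ)) * (match j with
      | 0 => X 0 1 + X 1 0
      | 1 => Complex.I * (X 0 1 - X 1 0)
      | 2 => X 0 0 - X 1 1
      | 3 => X 0 2 + X 2 0
      | 4 => Complex.I * (X 0 2 - X 2 0)
      | 5 => X 1 2 + X 2 1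
      | 6 => Complex.I * (X 1 2 - X 2 1)
      | 7 => ((Real.sqrt 3 : ℝ) : ℂ) * (X 0 0 + X 1 1)) := by
  have h22 : X 2 2 = - X 0 0 - X 1 1 := by
    rw [Matrix.trace_fin_three] at hX; linear_combination hX
  have h3 : ((Real.sqrt 3 : ℝ) : ℂ) ^ 2 = 3 := by
    exact_mod_cast Real.sq_sqrt (by norm_num : (0:ℝ) ≤ 3)
  have n3 : ((Real.sqrt 3 : ℝ) : ℂ) ≠ 0 := by simp
  have k3 : (1 : ℂ) / ((Real.sqrt 3 : ℝ) : ℂ) = ((Real.sqrt 3 : ℝ) : ℂ) / 3 := by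
    field_simp; rw [h3]
  rw [coord, conj_basisE, basisE, Matrix.neg_mul, Matrix.smul_mul, Matrix.trace_neg,
    Matrix.trace_smul, smul_eq_mul, neg_mul]
  congr 2
  have h8 : (gellMann 7 * X).trace = ((Real.sqrt 3 : ℝ) : ℂ) * (X 0 0 + X 1 1) := by
    simp only [gellMann, Matrix.smul_mul, Matrix.trace_smul, smul_eq_mul, Complex.ofReal_div,
      Complex.ofReal_one, k3]
    simp [Matrix.trace_fin_three, Matrix.vecMul, dotProduct, Fin.sum_univ_three, h22]
    ring
  fin_cases j
  on_goal 8 => exact h8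
  all_goals
    simp [gellMann, Matrix.trace_fin_three, Matrix.vecMul, dotProduct, Fin.sum_univ_three]
    try ring

theorem evalAt_tau (X : Mat) (hX : X.trace = 0) :
    evalAt X tau = 6 * ((Real.sqrt 6 : ℝ) : ℂ) * Complex.I * X.det := by
  have h22 : X 2 2 = - X 0 0 - X 1 1 := by
    rw [Matrix.trace_fin_three] at hX; linear_combination hX
  have h2 : ((Real.sqrt 2 : ℝ) : ℂ) ^ 2 = 2 := by
    exact_mod_cast Real.sq_sqrt (by norm_num : (0:ℝ) ≤ 2)
  have h3 : ((Real.sqrt 3 : ℝ) : ℂ) ^ 2 = 3 := by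
    exact_mod_cast Real.sq_sqrt (by norm_num : (0:ℝ) ≤ 3)
  have h6 : ((Real.sqrt 6 : ℝ) : ℂ) = (Real.sqrt 2 : ℂ) * (Real.sqrt 3 : ℂ) := by
    rw [← Complex.ofReal_mul, ← Real.sqrt_mul (by norm_num)]; norm_num
  have n2 : ((Real.sqrt 2 : ℝ) : ℂ) ≠ 0 := by simp
  have n3 : ((Real.sqrt 3 : ℝ) : ℂ) ≠ 0 := by simp
  have hI := Complex.I_sq
  have k2 : (1 : ℂ) / ((Real.sqrt 2 : ℝ) : ℂ) = ((Real.sqrt 2 : ℝ) : ℂ) / 2 := by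
    field_simp; rw [h2]
  have k4 : Complex.I / ((Real.sqrt 2 : ℝ) : ℂ) = Complex.I * ((Real.sqrt 2 : ℝ) : ℂ) / 2 := by
    rw [div_eq_mul_one_div, k2]; ring
  simp only [evalAt, tau, map_add, map_sub, map_mul, map_pow, MvPolynomial.aeval_X, map_ofNat,
    MvPolynomial.algHom_C, Matrix.det_fin_three, h6, coord_eq X hX, k4]
  simp only [h22, Algebra.algebraMap_self, RingHom.id_apply, Complex.ofReal_mul, Complex.ofReal_ofNat]
  generalize ((Real.sqrt 2 : ℝ) : ℂ) = a at *
  generalize ((Real.sqrt 3 : ℝ) : ℂ) = b at *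
  generalize Complex.I = i at *
  clear k2 k4 h6 n2 n3 hX h22
  grind

theorem evalAt_tau_orbit (ξ : RatOrbit) {x : Mat} (hx : x ∈ ξ.orb) :
    evalAt x tau = evalAt ξ.pt tau := by
  obtain ⟨g, rfl⟩ := hx
  have h0 : ξ.pt.trace = 0 := ξ.mem_Fbar.1.1.2
  change evalAt (Ad g ξ.pt) tau = _
  rw [evalAt_tau _ h0, evalAt_tau _ (by rw [trace_ad, h0]), det_ad]

theorem weight_eq (a b : ℝ) : weight a b = (Complex.I / 3) •
    !![2 * (a : ℂ) + b, 0, 0; 0, -a + b, 0; 0, 0, -a - 2 * b] := by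
  have h2 : ((Real.sqrt 2 : ℝ) : ℂ) ^ 2 = 2 := by
    exact_mod_cast Real.sq_sqrt (by norm_num : (0:ℝ) ≤ 2)
  have h3 : ((Real.sqrt 3 : ℝ) : ℂ) ^ 2 = 3 := by
    exact_mod_cast Real.sq_sqrt (by norm_num : (0:ℝ) ≤ 3)
  have h6 : ((Real.sqrt 6 : ℝ) : ℂ) = (Real.sqrt 2 : ℂ) * (Real.sqrt 3 : ℂ) := by
    rw [← Complex.ofReal_mul, ← Real.sqrt_mul (by norm_num)]; norm_num
  have n2 : ((Real.sqrt 2 : ℝ) : ℂ) ≠ 0 := by simp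
  have n3 : ((Real.sqrt 3 : ℝ) : ℂ) ≠ 0 := by simp
  ext i j
  fin_cases i <;> fin_cases j <;>
    simp [weight, fundWeight₁, fundWeight₂, basisE, gellMann, h6] <;> field_simp <;> grind

theorem tau_weight (a b : ℝ) : evalAt (weight a b) tau =
    (((2 * Real.sqrt 6 / 9) * ((2 * a + b) * (a - b) * (a + 2 * b)) : ℝ) : ℂ) := by
  rw [evalAt_tau]
  · rw [weight_eq, Matrix.det_smul, Matrix.det_fin_three]
    simp
    have hI := Complex.I_sq
    generalize Complex.I = i at *
    grind
  · rw [weight_eq]; simp [Matrix.trace_fin_three]; ring_nf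

theorem tau_injective {ξ ξ' : RatOrbit} (h : evalAt ξ.pt tau = evalAt ξ'.pt tau) : ξ = ξ' := by
  obtain ⟨x, ⟨⟨h1, h1'⟩, a, b, ha, hb, hxe⟩, hx⟩ := ξ
  obtain ⟨x', ⟨⟨h2, h2'⟩, c, d, hc, hd, hxe'⟩, hx'⟩ := ξ'
  subst hxe hxe'
  have key : ∀ a b : ℝ, ((weight a b)ᴴ * weight a b).trace = 1 → a ^ 2 + a * b + b ^ 2 = 3 / 2 := by
    intro a b h
    rw [weight_eq] at h
    have : (((2 / 3) * (a ^ 2 + a * b + b ^ 2) : ℝ) : ℂ) = ((1 : ℝ) : ℂ) := by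
      rw [Complex.ofReal_one, ← h]
      simp [Matrix.trace_fin_three, Matrix.mul_apply, Fin.sum_univ_three, Complex.conj_ofNat]
      have hI := Complex.I_sq
      generalize Complex.I = i at *
      grind
    have := Complex.ofReal_injective this
    linarith
  have k1 := key a b h1'
  have k2 := key c d h2'
  simp only [tau_weight] at h
  have h := Complex.ofReal_injective h
  have h := mul_left_cancel₀ (by positivity) h
  have hab := mul_nonneg ha hb
  have hcd := mul_nonneg hc hd
  have e : ((a - b) - (c - d)) *
      (9 / 2 - ((a - b) ^ 2 + (a - b) * (c - d) + (c - d) ^ 2)) = 0 := by grind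
  have e1 : a - b = c - d := by
    rcases mul_eq_zero.1 e with e | e
    · linarith
    · have : ((a - b) - (c - d)) ^ 2 ≤ 0 := by nlinarith
      have := pow_eq_zero_iff (two_ne_zero) |>.1 (le_antisymm this (sq_nonneg _))
      linarith
  have e2 : (a + b) ^ 2 = (c + d) ^ 2 := by
    have : (a - b) ^ 2 = (c - d) ^ 2 := by rw [e1]
    nlinarith
  have e3 : a + b = c + d := by
    rwa [sq_eq_sq₀ (by positivity) (by positivity)] at e2
  obtain rfl : a = c := by linarith
  obtain rfl : b = d := by linarith
  rfl

theorem tauCheck_apply (ξ : RatOrbit) (x : S7) :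
    (tauCheck ξ).1 x = evalAt x.1 tau - evalAt ξ.pt tau := rfl

theorem toOrbit_apply (ξ : RatOrbit) (f : Poly S7) (x : ξ.orb) :
    (toOrbit ξ f).1 x = f.1 ⟨x.1, ξ.orb_subset x.2⟩ := rfl

theorem toOrbit_tauCheck (ξ ξ' : RatOrbit) : toOrbit ξ (tauCheck ξ') =
    algebraMap ℂ _ (evalAt ξ.pt tau - evalAt ξ'.pt tau) := by
  ext x
  rw [toOrbit_apply, tauCheck_apply, evalAt_tau_orbit ξ x.2]
  rfl

open Classical in
theorem toOrbit_delta {P : Finset RatOrbit} {ξ ξ' : RatOrbit} (h' : ξ' ∈ P) :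
    toOrbit ξ' (delta P ξ) = if ξ' = ξ then 1 else 0 := by
  rw [delta, map_smul, map_prod]
  simp only [toOrbit_tauCheck, tauCheck_apply]
  rw [← map_prod, Algebra.smul_def, ← map_mul]
  split_ifs with he
  · subst he
    rw [inv_mul_cancel₀, map_one]
    refine Finset.prod_ne_zero_iff.2 fun η hη h0 => ?_
    exact (Finset.mem_erase.1 hη).1 (tau_injective (sub_eq_zero.1 h0)).symm
  · have h0 : ∏ η ∈ P.erase ξ, (evalAt ξ'.pt tau - evalAt η.pt tau) = 0 :=
      Finset.prod_eq_zero (Finset.mem_erase.2 ⟨he, h'⟩) (sub_self _)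
    rw [h0, mul_zero, map_zero]

theorem cls_eq {P : Finset RatOrbit} {f g : Poly S7}
    (h : ∀ ξ ∈ P, toOrbit ξ f = toOrbit ξ g) : cls P f = cls P g := by
  refine Ideal.Quotient.eq.2 ?_
  simp only [vanishing, Submodule.mem_iInf, RingHom.mem_ker]
  intro ξ hξ
  rw [map_sub, h ξ hξ, sub_self]

theorem component_cls {P : Finset RatOrbit} {ξ : RatOrbit} (hξ : ξ ∈ P) (f : Poly S7) :
    component hξ (cls P f) = toOrbit ξ f := rfl

theorem deltaMul_toOrbit {P : Finset RatOrbit} {ξ : RatOrbit} (f : Poly S7) :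
    deltaMul P ξ (toOrbit ξ f) = cls P (delta P ξ * f) := by
  classical
  refine cls_eq fun η hη => ?_
  simp only [LinearMap.mulLeft_apply, LinearMap.comp_apply, map_mul, toOrbit_delta hη]
  split_ifs with h
  · subst h; rw [toOrbit_lift]
  · simp

open Classical in
theorem component_deltaMul {P : Finset RatOrbit} {ξ η : RatOrbit} (hη : η ∈ P) (f : Poly S7) :
    component hη (deltaMul P ξ (toOrbit ξ f)) = if η = ξ then toOrbit η f else 0 := by
  rw [deltaMul_toOrbit, component_cls, map_mul, toOrbit_delta hη]
  split_ifs <;> simp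

theorem component_sum {P : Finset RatOrbit} (f : ∀ ξ : RatOrbit, Poly ξ.orb)
    {η : RatOrbit} (hη : η ∈ P) :
    component hη (∑ ξ ∈ P, deltaMul P ξ (f ξ)) = f η := by
  rw [map_sum, Finset.sum_eq_single η]
  · obtain ⟨g, hg⟩ := toOrbit_surjective η (f η)
    rw [← hg, component_deltaMul, if_pos rfl]
  · intro ξ _ hne
    obtain ⟨g, hg⟩ := toOrbit_surjective ξ (f ξ)
    rw [← hg, component_deltaMul, if_neg hne.symm]
  · exact fun h => (h hη).elim

theorem component_glued (R : ∀ ξ : RatOrbit, Ray ξ) {P : Finset RatOrbit} (s : ℕ+) (u : Usl3)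
    {ξ : RatOrbit} (hξ : ξ ∈ P) : component hξ (glued R P s u) = (R ξ).w s u := by
  simp only [glued, LinearMap.sum_apply, LinearMap.comp_apply]
  exact component_sum (fun ξ => (R ξ).w s u) hξ

theorem twisted_eq {V : Type} [AddCommGroup V] [Module ℂ V] (w : Usl3 →ₗ[ℂ] V)
    (hw : ∀ u v u' v', w u = w u' → w v = w v' → w (u * v) = w (u' * v')) (u v : Usl3) :
    twisted w (w u) (w v) = w (u * v) :=
  hw _ _ _ _ (Function.invFun_eq ⟨u, rfl⟩) (Function.invFun_eq ⟨v, rfl⟩)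

theorem Ray.mul_congr {ξ : RatOrbit} (R : Ray ξ) (s : ℕ+) (u v u' v' : Usl3)
    (hu : R.w s u = R.w s u') (hv : R.w s v = R.w s v') : R.w s (u * v) = R.w s (u' * v') := by
  obtain ⟨Q, W, hW, hw⟩ := R.universal s
  rw [hw] at hu hv ⊢
  have hu : Q.rep u = Q.rep u' := hW.injective hu
  have hv : Q.rep v = Q.rep v' := hW.injective hv
  simp [hu, hv]

/-- On a ray, `w[u] ⋆ w[v] = w[uv]`. -/
theorem Ray.twisted_apply {ξ : RatOrbit} (R : Ray ξ) (s : ℕ+) (u v : Usl3) :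
    twisted (R.w s) (R.w s u) (R.w s v) = R.w s (u * v) :=
  twisted_eq _ (R.mul_congr s) u v

theorem glued_eq_iff (R : ∀ ξ : RatOrbit, Ray ξ) {P : Finset RatOrbit} (s : ℕ+) {u v : Usl3} :
    glued R P s u = glued R P s v ↔ ∀ ξ ∈ P, (R ξ).w s u = (R ξ).w s v := by
  constructor
  · intro h ξ hξ
    rw [← component_glued R s u hξ, h, component_glued]
  · intro h
    simp only [glued, LinearMap.sum_apply, LinearMap.comp_apply]
    exact Finset.sum_congr rfl fun ξ hξ => by rw [h ξ hξ]

/-- For the glued correspondence, `w_𝒫[u] ⋆ w_𝒫[v] = w_𝒫[uv]`. -/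
theorem twisted_glued (R : ∀ ξ : RatOrbit, Ray ξ) (P : Finset RatOrbit) (s : ℕ+) (u v : Usl3) :
    twisted (glued R P s) (glued R P s u) (glued R P s v) = glued R P s (u * v) := by
  refine twisted_eq _ (fun u v u' v' hu hv => ?_) u v
  rw [glued_eq_iff] at hu hv ⊢
  exact fun ξ hξ => (R ξ).mul_congr s _ _ _ _ (hu ξ hξ) (hv ξ hξ)

/-- `[w_𝒫[u], w_𝒫[v]]^r = ∑_{ξ ∈ 𝒫} 𝔡^ξ_𝒫 r(ξ) [w_ξ[u], w_ξ[v]]_⋆`. -/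
theorem weightedBracket_glued (R : ∀ ξ : RatOrbit, Ray ξ) (P : Finset RatOrbit) (s : ℕ+)
    (u v : Usl3) : weightedBracket R P s (glued R P s u) (glued R P s v) =
      ∑ ξ ∈ P, deltaMul P ξ ((intRadius ξ : ℂ) •
        twistedComm ((R ξ).w s) ((R ξ).w s u) ((R ξ).w s v)) := by
  have h (u : Usl3) : ∀ ξ ∈ P, (R ξ).w s (Function.invFun (glued R P s) (glued R P s u)) =
      (R ξ).w s u := (glued_eq_iff R s).1 (Function.invFun_eq ⟨u, rfl⟩)
  exact Finset.sum_congr rfl fun ξ hξ => by rw [h u ξ hξ, h v ξ hξ]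

theorem structConst_antisymm (j k l : Fin 8) : structConst j k l = -structConst k j l := by
  rw [structConst, structConst, ← Matrix.trace_neg, ← Matrix.mul_neg, neg_sub]

theorem structConst_rotate (j k l : Fin 8) : structConst k l j = -structConst k j l := by
  simp only [structConst, conj_basisE, Matrix.mul_sub, Matrix.neg_mul, Matrix.trace_sub,
    Matrix.trace_neg]
  have h1 : (basisE l * (basisE k * basisE j)).trace = (basisE j * (basisE l * basisE k)).trace := by
    rw [← Matrix.mul_assoc, Matrix.trace_mul_comm, ← Matrix.mul_assoc]
  have h2 : (basisE l * (basisE j * basisE k)).trace = (basisE j * (basisE k * basisE l)).trace := by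
    rw [Matrix.trace_mul_comm, Matrix.mul_assoc]
  rw [h1, h2]
  ring

theorem basis_expansion (X : Mat) (hX : X.trace = 0) : X = ∑ l, coord l X • basisE l := by
  have h22 : X 2 2 = - X 0 0 - X 1 1 := by
    rw [Matrix.trace_fin_three] at hX; linear_combination hX
  have h2 : ((Real.sqrt 2 : ℝ) : ℂ) ^ 2 = 2 := by
    exact_mod_cast Real.sq_sqrt (by norm_num : (0:ℝ) ≤ 2)
  have h3 : ((Real.sqrt 3 : ℝ) : ℂ) ^ 2 = 3 := by
    exact_mod_cast Real.sq_sqrt (by norm_num : (0:ℝ) ≤ 3)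
  have n2 : ((Real.sqrt 2 : ℝ) : ℂ) ≠ 0 := by simp
  have n3 : ((Real.sqrt 3 : ℝ) : ℂ) ≠ 0 := by simp
  have hI := Complex.I_sq
  ext a b
  simp only [Fin.sum_univ_eight, coord_eq X hX, basisE, gellMann, smul_smul]
  fin_cases a <;> fin_cases b <;>
    simp [h22] <;>
    field_simp <;> generalize Complex.I = i at * <;> clear hX h22 <;> grind

theorem coord_comm (k j : Fin 8) (X : Mat) (hX : X.trace = 0) :
    coord j (basisE k * X - X * basisE k) = -∑ l, structConst k j l * coord l X := by
  conv_lhs => rw [basis_expansion X hX]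
  simp only [coord, Finset.mul_sum, Finset.sum_mul, ← Finset.sum_sub_distrib, Matrix.trace_sum,
    Matrix.mul_smul, Matrix.smul_mul, ← smul_sub, Matrix.trace_smul, smul_eq_mul]
  rw [← Finset.sum_neg_distrib]
  refine Finset.sum_congr rfl fun l _ => ?_
  rw [← neg_mul, ← structConst_rotate, mul_comm]
  rfl

theorem hasDerivAt_evalAt (c : ℝ → Mat) (c' : Mat)
    (h : ∀ j, HasDerivAt (fun t => coord j (c t)) (coord j c') 0) (F : PolyAlg) :
    HasDerivAt (fun t => evalAt (c t) F)
      (∑ j, evalAt (c 0) (MvPolynomial.pderiv j F) * coord j c') 0 := by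
  classical
  induction F using MvPolynomial.induction_on with
  | C a => simpa [evalAt] using hasDerivAt_const (0 : ℝ) a
  | add p q hp hq =>
    simp only [map_add, add_mul, Finset.sum_add_distrib]
    exact hp.add hq
  | mul_X p i hp =>
    have hX : ∀ t, evalAt (c t) (MvPolynomial.X i) = coord i (c t) := fun t => by simp [evalAt]
    simp only [map_mul, hX]
    refine (hp.mul (h i)).congr_deriv (Eq.symm ?_)
    simp only [Derivation.leibniz, MvPolynomial.pderiv_X, smul_eq_mul, map_add, map_mul, hX, add_mul,
      Finset.sum_add_distrib, Finset.sum_mul]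
    rw [add_comm]
    congr 1
    · exact Finset.sum_congr rfl fun j _ => by ring
    · rw [Finset.sum_eq_single i] <;> simp +contextual

theorem exists_SU3_conj (U : Mat) (hU : U * Uᴴ = 1) : ∃ g : SU3, ∀ X, Ad g X = U * X * Uᴴ := by
  have hd : U.det * star U.det = 1 := by
    rw [← Matrix.det_conjTranspose, ← Matrix.det_mul, hU, Matrix.det_one]
  obtain ⟨z, hz⟩ := IsAlgClosed.exists_pow_nat_eq (star U.det) (n := 3) (by norm_num)
  have hzz : z * star z = 1 := by
    have h1 : (z * star z) ^ 3 = 1 := by rw [mul_pow, ← star_pow, hz, star_star, mul_comm, hd]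
    have h2 : z * star z = ((Complex.normSq z : ℝ) : ℂ) := Complex.mul_conj z
    rw [h2] at h1 ⊢
    have h3 : Complex.normSq z ^ 3 = 1 := by exact_mod_cast h1
    rw [(pow_eq_one_iff_of_nonneg (Complex.normSq_nonneg z) (by norm_num)).1 h3]
    simp
  have hm : z • U ∈ SU3 := by
    rw [Matrix.mem_specialUnitaryGroup_iff, Matrix.mem_unitaryGroup_iff]
    constructor
    · rw [Matrix.star_eq_conjTranspose, Matrix.conjTranspose_smul, Matrix.smul_mul, Matrix.mul_smul,
        smul_smul, hzz, hU, one_smul]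
    · rw [Matrix.det_smul, Fintype.card_fin, hz, mul_comm, hd]
  refine ⟨⟨z • U, hm⟩, fun X => ?_⟩
  change (z • U) * X * (z • U)ᴴ = _
  rw [Matrix.conjTranspose_smul, Matrix.smul_mul, Matrix.smul_mul, Matrix.mul_smul, smul_smul, hzz,
    one_smul]

section
attribute [local instance] Matrix.linftyOpNormedRing Matrix.linftyOpNormedAlgebra

theorem exists_curve (A X : Mat) (hA : Aᴴ = -A) : ∃ c : ℝ → Mat, c 0 = X ∧
    (∀ t, ∃ g : SU3, c t = Ad g X) ∧
    ∀ j, HasDerivAt (fun t => coord j (c t)) (coord j (A * X - X * A)) 0 := by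
  refine ⟨fun t => NormedSpace.exp (t • A) * X * NormedSpace.exp (t • (-A)), by simp, ?_, ?_⟩
  · intro t
    have h1 : NormedSpace.exp (t • (-A)) = (NormedSpace.exp (t • A))ᴴ := by
      rw [← Matrix.exp_conjTranspose, Matrix.conjTranspose_smul, hA]; simp
    obtain ⟨g, hg⟩ := exists_SU3_conj (NormedSpace.exp (t • A)) (by
      rw [← h1, ← Matrix.exp_add_of_commute]
      · simp
      · rw [smul_neg]; exact (Commute.refl _).neg_right)
    exact ⟨g, by rw [hg]; simp only [h1]⟩
  · intro j
    have h1 := hasDerivAt_exp_smul_const (𝕂 := ℝ) A (0 : ℝ)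
    have h2 := hasDerivAt_exp_smul_const (𝕂 := ℝ) (-A) (0 : ℝ)
    have h3 := (h1.mul_const X).mul h2
    let L : Mat →ₗ[ℝ] ℂ :=
      { toFun := coord j
        map_add' := fun x y => by simp [coord, Matrix.mul_add]
        map_smul' := fun r x => by simp [coord] }
    have h4 := (LinearMap.toContinuousLinearMap L).hasFDerivAt.comp_hasDerivAt (0 : ℝ) h3
    refine h4.congr_deriv ?_
    change coord j _ = coord j _
    congr 1
    simp [sub_eq_add_neg]
end

theorem bracket_eval (F G : PolyAlg) (X : Mat) (hX : X.trace = 0) :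
    evalAt X (bracket F G) = -∑ k, (∑ j, evalAt X (MvPolynomial.pderiv j F) *
      coord j (basisE k * X - X * basisE k)) * evalAt X (MvPolynomial.pderiv k G) := by
  have hC : ∀ a, evalAt X (MvPolynomial.C a) = a := fun a => by simp [evalAt]
  have hXl : ∀ l, evalAt X (MvPolynomial.X l) = coord l X := fun l => by simp [evalAt]
  simp only [bracket, map_sum, map_mul, hC, hXl, coord_comm _ _ X hX]
  rw [Finset.sum_comm, ← Finset.sum_neg_distrib]
  refine Finset.sum_congr rfl fun k _ => ?_
  rw [Finset.sum_mul, ← Finset.sum_neg_distrib]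
  refine Finset.sum_congr rfl fun j _ => ?_
  rw [mul_neg, neg_mul, neg_neg, Finset.mul_sum, Finset.sum_mul]
  exact Finset.sum_congr rfl fun l _ => by ring

theorem bracket_antisymm (F G : PolyAlg) : bracket F G = -bracket G F := by
  rw [bracket, bracket, Finset.sum_comm, ← Finset.sum_neg_distrib]
  refine Finset.sum_congr rfl fun k _ => ?_
  rw [← Finset.sum_neg_distrib]
  refine Finset.sum_congr rfl fun j _ => ?_
  rw [← Finset.sum_neg_distrib]
  refine Finset.sum_congr rfl fun l _ => ?_
  rw [structConst_antisymm, map_neg]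
  ring

theorem bracket_congr {S : Set Mat} (hS : S ⊆ su3) (hAd : ∀ (g : SU3), ∀ X ∈ S, Ad g X ∈ S)
    {F F' : PolyAlg} (h : toPoly S F = toPoly S F') (G : PolyAlg) :
    toPoly S (bracket F G) = toPoly S (bracket F' G) := by
  have hv : ∀ X ∈ S, evalAt X (F - F') = 0 := fun X hX => by
    have := congrFun (congrArg Subtype.val h) ⟨X, hX⟩
    rw [map_sub, sub_eq_zero]; exact this
  refine Subtype.ext (funext fun X => ?_)
  change evalAt X.1 _ = evalAt X.1 _
  have hb : bracket F G - bracket F' G = bracket (F - F') G := by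
    simp only [bracket, ← Finset.sum_sub_distrib, map_sub]
    refine Finset.sum_congr rfl fun _ _ => Finset.sum_congr rfl fun _ _ =>
      Finset.sum_congr rfl fun _ _ => by ring
  rw [← sub_eq_zero, ← map_sub, hb, bracket_eval _ _ _ (hS X.2).2, neg_eq_zero]
  refine Finset.sum_eq_zero fun k _ => ?_
  obtain ⟨c, h0, hc, hd⟩ := exists_curve (basisE k) X.1 (conj_basisE k)
  have h1 := hasDerivAt_evalAt c _ hd (F - F')
  have h2 : (fun t => evalAt (c t) (F - F')) = fun _ => 0 := funext fun t => by
    obtain ⟨g, hg⟩ := hc t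
    rw [hg]; exact hv _ (hAd g _ X.2)
  rw [h2, h0] at h1
  rw [h1.unique (hasDerivAt_const _ _), zero_mul]

/-- On an `Ad`-invariant subset of `su(3)`, the Poisson bracket is the restriction of the Poisson
bracket of arbitrary polynomial extensions. -/
theorem poisson_toPoly {S : Set Mat} (hS : S ⊆ su3) (hAd : ∀ (g : SU3), ∀ X ∈ S, Ad g X ∈ S)
    (F G : PolyAlg) : poisson (toPoly S F) (toPoly S G) = toPoly S (bracket F G) := by
  have neg (F : PolyAlg) : toPoly S (-F) = -toPoly S F := Subtype.ext (map_neg (restr S) F)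
  rw [poisson, bracket_congr hS hAd (toPoly_extend (toPoly S F)), bracket_antisymm, neg,
    bracket_congr hS hAd (toPoly_extend (toPoly S G)), ← neg, ← bracket_antisymm]

end

end Magoo

/-! Restriction to the orbits of a finite set `P` embeds `PolyOver P` in the product of the algebras
of the orbits. The polynomials `delta P ξ` become the idempotents of this product, so the component
of the glued correspondence at `ξ` is the correspondence of the `ξ`-ray. Hence, on the image, the
glued product and the weighted bracket are computed component by component
(`component_twisted_glued`, `component_weightedBracket`). The Poisson bracket restricts to orbits as
well (`toOrbit_poisson`). Since `P` is finite, uniform convergence over its orbits is convergence on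
each of them; and the limit in `n` is an equality of components for every `n`. As the chain exhausts
the rational orbits and every polynomial function on an orbit extends to the sphere, the conditions
on the sphere become those on the rays.

The delicate point is the image: functions that lie separately in the images of the rays must come
from one common element of the enveloping algebra (`mem_range_glued`). This holds because `Usl3`
maps onto the product of the operator algebras of the representations involved (`exists_rep_eq`), by
Jacobson density for pairwise non-isomorphic simple modules.

Non-isomorphism needs distinct weights, which `firstWeight_smul_injective` provides, and the fact
that the isomorphism class determines the highest weight (`QuarkSystem.weight_eq_of_equiv`). The
latter is proved with gradings of `sl3` in degrees -1, 0 and 1: in an irreducible representation the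
eigenvalues of the grading element descend by natural numbers from the highest one, so an
isomorphism in both directions forces the top eigenvalues to agree. -/

/-! ### Jacobson density for several simple modules -/

/-- Joint density: finitely many finite-dimensional simple modules over an algebra over an
algebraically closed field, without nonzero maps between distinct ones, admit a common algebra
element acting by prescribed linear maps. -/
theorem exists_forall_smul_eq {k R ι : Type*} [Field k] [IsAlgClosed k] [Ring R] [Algebra k R]
    [Fintype ι] (M : ι → Type*) [∀ i, AddCommGroup (M i)] [∀ i, Module k (M i)]
    [∀ i, Module R (M i)] [∀ i, IsScalarTower k R (M i)] [∀ i, FiniteDimensional k (M i)]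
    [∀ i, IsSimpleModule R (M i)] (hne : ∀ i j, i ≠ j → ∀ φ : M i →ₗ[R] M j, φ = 0)
    (A : ∀ i, M i →ₗ[k] M i) : ∃ r : R, ∀ i (m : M i), r • m = A i m := by
  classical
  -- By Schur's lemma and the absence of maps between different factors, every endomorphism of the
  -- product is a scalar on each factor.
  have scalar (φ : Module.End R (∀ i, M i)) (i : ι) : ∃ c : k, ∀ x, φ x i = c • x i := by
    obtain ⟨c, hc⟩ := (IsSimpleModule.algebraMap_end_bijective_of_isAlgClosed k).2
      ((LinearMap.proj i ∘ₗ φ) ∘ₗ LinearMap.single R M i)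
    refine ⟨c, fun x => ?_⟩
    have hx : x = ∑ j, LinearMap.single R M j (x j) := by
      simp [LinearMap.single_apply, Finset.univ_sum_single]
    conv_lhs => rw [hx, map_sum, Finset.sum_apply]
    rw [Finset.sum_eq_single i]
    · exact (LinearMap.congr_fun hc (x i)).symm
    · intro j _ hj
      exact LinearMap.congr_fun (hne j i hj ((LinearMap.proj i ∘ₗ φ) ∘ₗ LinearMap.single R M j)) (x j)
    · simp
  -- The prescribed maps together commute with these factorwise scalars, so they form an element of
  -- the bicommutant, to which density applies.
  let f : Module.End (Module.End R (∀ i, M i)) (∀ i, M i) :=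
    { toFun := fun x i => A i (x i)
      map_add' := fun x y => by ext; simp
      map_smul' := fun φ x => by
        ext i
        obtain ⟨c, hc⟩ := scalar φ i
        simp [hc] }
  let b := fun i => Module.finBasis k (M i)
  -- Density gives agreement on a finite set only; bases of all the factors suffice, by linearity
  -- over `k`.
  obtain ⟨r, hr⟩ := jacobson_density f
    (Finset.univ.image fun p : Σ i, Fin (Module.finrank k (M i)) => Pi.single p.1 (b p.1 p.2))
  refine ⟨r, fun i m => ?_⟩
  have h : Algebra.lsmul k k (M i) r = A i := (b i).ext fun l => by
    have := congrFun (hr (Pi.single i (b i l)) (Finset.mem_image.2 ⟨⟨i, l⟩, by simp⟩)) i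
    simpa [f] using this.symm
  exact LinearMap.congr_fun h m

namespace Magoo

noncomputable section

attribute [local instance] LieRing.ofAssociativeRing

/-! ### Gradings of the Lie algebra -/

/-- A matrix is homogeneous of degree `m` with respect to `γ` if its nonzero entries are at the
positions `(i, j)` with `γ i - γ j = m`. -/
def HasDegree (γ : Fin 3 → ℤ) (m : ℤ) (X : sl3) : Prop :=
  ∀ i j, γ i - γ j ≠ m → X.1 i j = 0

/-- The traceless diagonal matrix whose adjoint action has eigenvalue `m` in degree `m`. -/
def gradingElement (γ : Fin 3 → ℤ) : sl3 :=
  ⟨Matrix.diagonal fun i => (γ i : ℂ) - (∑ j, (γ j : ℂ)) / 3, by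
    simp [LieAlgebra.SpecialLinear.sl, Fin.sum_univ_three]; ring⟩

/-- Bracketing with a diagonal matrix multiplies the entry at `(i, j)` by the difference of its
diagonal entries, in which the mean subtracted for tracelessness cancels. -/
theorem lie_gradingElement {γ : Fin 3 → ℤ} {m : ℤ} {X : sl3} (hX : HasDegree γ m X) :
    ⁅gradingElement γ, X⁆ = (m : ℂ) • X := by
  apply Subtype.ext
  ext i j
  simp only [LieSubalgebra.coe_bracket, Ring.lie_def, gradingElement, Matrix.sub_apply,
    Matrix.diagonal_mul, Matrix.mul_diagonal, SetLike.val_smul, Matrix.smul_apply, smul_eq_mul]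
  by_cases h : γ i - γ j = m
  · rw [← h]; push_cast; ring
  · rw [hX i j h]; ring

theorem HasDegree.lie {γ : Fin 3 → ℤ} {m n : ℤ} {X Y : sl3} (hX : HasDegree γ m X)
    (hY : HasDegree γ n Y) : HasDegree γ (m + n) ⁅X, Y⁆ := by
  intro i j h
  simp only [LieSubalgebra.coe_bracket, Ring.lie_def, Matrix.sub_apply, Matrix.mul_apply]
  rw [Finset.sum_eq_zero, Finset.sum_eq_zero, sub_zero]
  · intro k _
    by_cases h1 : γ i - γ k = n
    · rw [hX k j (by omega), mul_zero]
    · rw [hY i k h1, zero_mul]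
  · intro k _
    by_cases h1 : γ i - γ k = m
    · rw [hY k j (by omega), mul_zero]
    · rw [hX i k h1, zero_mul]

/-- The homogeneous part of degree `m` of a traceless matrix. -/
def homogeneousPart (γ : Fin 3 → ℤ) (m : ℤ) (X : sl3) : sl3 :=
  ⟨Matrix.of fun i j => if γ i - γ j = m then X.1 i j else 0, by
    have h : X.1.trace = 0 := X.2
    change Matrix.trace (Matrix.of fun i j => if γ i - γ j = m then X.1 i j else 0) = 0
    -- The diagonal has degree 0, so the part keeps the whole trace or has zero diagonal.
    by_cases hm : m = 0
    · rw [← h]; simp [Matrix.trace, hm]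
    · simp [Matrix.trace, Ne.symm hm]⟩

theorem hasDegree_homogeneousPart (γ : Fin 3 → ℤ) (m : ℤ) (X : sl3) :
    HasDegree γ m (homogeneousPart γ m X) := fun _ _ h => if_neg h

theorem homogeneousPart_add_add {γ : Fin 3 → ℤ} (hγ : ∀ i j, γ i - γ j ≤ 1) (X : sl3) :
    X = homogeneousPart γ (-1) X + homogeneousPart γ 0 X + homogeneousPart γ 1 X := by
  apply Subtype.ext
  ext i j
  have h1 := hγ i j
  have h2 := hγ j i
  -- The hypothesis at `(i, j)` and at `(j, i)` leaves only three degrees.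
  have h3 : γ i - γ j = -1 ∨ γ i - γ j = 0 ∨ γ i - γ j = 1 := by omega
  rcases h3 with h | h | h <;> simp [homogeneousPart, h]

/-! ### Eigenvalues of the grading element in an irreducible representation -/

section Rep

variable {d : ℕ} (D : sl3 →ₗ⁅ℂ⁆ Matrix (Fin d) (Fin d) ℂ)

theorem lie_mulVec (X Y : sl3) (v : Fin d → ℂ) :
    D ⁅X, Y⁆ *ᵥ v = D X *ᵥ (D Y *ᵥ v) - D Y *ᵥ (D X *ᵥ v) := by
  rw [LieHom.map_lie, Ring.lie_def, Matrix.sub_mulVec, Matrix.mulVec_mulVec, Matrix.mulVec_mulVec]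

/-- The spans of the `k`-fold lowerings (by matrices of degree `-1`) of the eigenvectors of the
grading element of eigenvalue `c` that are annihilated by the matrices of degree `1`. -/
def lowering (γ : Fin 3 → ℤ) (c : ℂ) : ℕ → Submodule ℂ (Fin d → ℂ)
  | 0 =>
    { carrier := {w | D (gradingElement γ) *ᵥ w = c • w ∧ ∀ X, HasDegree γ 1 X → D X *ᵥ w = 0}
      zero_mem' := by simp
      add_mem' := by
        rintro v w ⟨h1, h2⟩ ⟨h3, h4⟩
        refine ⟨by rw [Matrix.mulVec_add, h1, h3, smul_add], fun X hX => ?_⟩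
        rw [Matrix.mulVec_add, h2 X hX, h4 X hX, add_zero]
      smul_mem' := by
        rintro a w ⟨h1, h2⟩
        refine ⟨by rw [Matrix.mulVec_smul, h1, smul_comm], fun X hX => ?_⟩
        rw [Matrix.mulVec_smul, h2 X hX, smul_zero] }
  | k + 1 => Submodule.span ℂ {w | ∃ X, HasDegree γ (-1) X ∧ ∃ v ∈ lowering γ c k, w = D X *ᵥ v}

variable {D} {γ : Fin 3 → ℤ} {c : ℂ}

theorem mulVec_lowering_of_degree_neg_one {X : sl3} (hX : HasDegree γ (-1) X) {k : ℕ}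
    {v : Fin d → ℂ}
    (hv : v ∈ lowering D γ c k) : D X *ᵥ v ∈ lowering D γ c (k + 1) :=
  Submodule.subset_span ⟨X, hX, v, hv, rfl⟩

theorem mulVec_mem_of_span {S : Set (Fin d → ℂ)} {N : Submodule ℂ (Fin d → ℂ)}
    {A : Matrix (Fin d) (Fin d) ℂ} (h : ∀ w ∈ S, A *ᵥ w ∈ N) {v : Fin d → ℂ}
    (hv : v ∈ Submodule.span ℂ S) : A *ᵥ v ∈ N :=
  (Submodule.span_le (p := N.comap A.mulVecLin)).2 h hv

/-- Moving `X` past a lowering `Y` costs the commutator `⁅X, Y⁆`, again of degree -1. At the bottom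
of the induction, `X` commutes with the grading element, and brackets of degree 1 with it have
degree 1, so both defining conditions persist. -/
theorem mulVec_lowering_of_degree_zero {X : sl3} (hX : HasDegree γ 0 X) {k : ℕ} {v : Fin d → ℂ}
    (hv : v ∈ lowering D γ c k) : D X *ᵥ v ∈ lowering D γ c k := by
  induction k generalizing X v with
  | zero =>
    obtain ⟨h1, h2⟩ := hv
    constructor
    · have h3 := lie_mulVec D (gradingElement γ) X v
      rw [lie_gradingElement hX, h1] at h3
      simp only [Int.cast_zero, zero_smul, map_zero, Matrix.zero_mulVec, Matrix.mulVec_smul] at h3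
      exact sub_eq_zero.1 h3.symm
    · intro Y hY
      have h3 := lie_mulVec D Y X v
      rw [h2 _ (hY.lie hX), h2 Y hY, Matrix.mulVec_zero, sub_zero] at h3
      exact h3.symm
  | succ k ih =>
    refine mulVec_mem_of_span ?_ hv
    rintro _ ⟨Y, hY, w, hw, rfl⟩
    have h3 := lie_mulVec D X Y w
    rw [eq_sub_iff_add_eq] at h3
    rw [← h3]
    refine add_mem (mulVec_lowering_of_degree_neg_one ?_ hw) (mulVec_lowering_of_degree_neg_one hY (ih hX hw))
    simpa using hX.lie hY

/-- The commutator of a raising and a lowering has degree 0 and so preserves each level. Raising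
therefore undoes one lowering; the induction starts from the vectors that raisings annihilate. -/
theorem mulVec_lowering_of_degree_one {X : sl3} (hX : HasDegree γ 1 X) {k : ℕ} {v : Fin d → ℂ}
    (hv : v ∈ lowering D γ c (k + 1)) : D X *ᵥ v ∈ lowering D γ c k := by
  induction k generalizing X v with
  | zero =>
    refine mulVec_mem_of_span ?_ hv
    rintro _ ⟨Y, hY, w, hw, rfl⟩
    have h3 := lie_mulVec D X Y w
    rw [hw.2 X hX, Matrix.mulVec_zero, sub_zero] at h3
    rw [← h3]
    exact mulVec_lowering_of_degree_zero (by simpa using hX.lie hY) hw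
  | succ k ih =>
    refine mulVec_mem_of_span ?_ hv
    rintro _ ⟨Y, hY, w, hw, rfl⟩
    have h3 := lie_mulVec D X Y w
    rw [eq_sub_iff_add_eq] at h3
    rw [← h3]
    exact add_mem (mulVec_lowering_of_degree_zero (by simpa using hX.lie hY) hw)
      (mulVec_lowering_of_degree_neg_one hY (ih hX hw))

theorem lowering_le_eigenspace (k : ℕ) : lowering D γ c k ≤
    Module.End.eigenspace (D (gradingElement γ)).mulVecLin (c - k) := by
  induction k with
  | zero =>
    rintro v ⟨h1, _⟩
    simpa [Module.End.mem_eigenspace_iff] using h1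
  | succ k ih =>
    refine Submodule.span_le.2 ?_
    rintro _ ⟨Y, hY, w, hw, rfl⟩
    have h1 := Module.End.mem_eigenspace_iff.1 (ih hw)
    have h3 := lie_mulVec D (gradingElement γ) Y w
    simp only [Matrix.mulVecLin_apply] at h1
    rw [lie_gradingElement hY, h1, map_smul, Matrix.smul_mulVec, Matrix.mulVec_smul,
      eq_sub_iff_add_eq] at h3
    refine Module.End.mem_eigenspace_iff.2 ?_
    rw [Matrix.mulVecLin_apply, ← h3, ← add_smul]
    congr 1
    push_cast
    ring

/-- Each homogeneous part shifts the level by at most one, and raising kills level 0. This exhibits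
a subrepresentation without an ordered-monomial basis of the enveloping algebra. -/
theorem iSup_lowering_invariant (hγ : ∀ i j, γ i - γ j ≤ 1) (X : sl3) {v : Fin d → ℂ}
    (hv : v ∈ ⨆ k, lowering D γ c k) : D X *ᵥ v ∈ ⨆ k, lowering D γ c k := by
  suffices h : (⨆ k, lowering D γ c k) ≤ (⨆ k, lowering D γ c k).comap (D X).mulVecLin from h hv
  refine iSup_le fun k w hw => ?_
  have mem {k : ℕ} {w : Fin d → ℂ} (hw : w ∈ lowering D γ c k) : w ∈ ⨆ k, lowering D γ c k :=
    Submodule.mem_iSup_of_mem k hw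
  rw [Submodule.mem_comap, Matrix.mulVecLin_apply, homogeneousPart_add_add hγ X, map_add, map_add,
    Matrix.add_mulVec, Matrix.add_mulVec]
  refine add_mem (add_mem (mem (mulVec_lowering_of_degree_neg_one (hasDegree_homogeneousPart _ _ _) hw))
    (mem (mulVec_lowering_of_degree_zero (hasDegree_homogeneousPart _ _ _) hw))) ?_
  cases k with
  | zero => rw [hw.2 _ (hasDegree_homogeneousPart _ _ _)]; exact zero_mem _
  | succ k => exact mem (mulVec_lowering_of_degree_one (hasDegree_homogeneousPart _ _ _) hw)

/-- In an irreducible representation with a vector of weight `c` that is annihilated in degree `1`,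
the eigenvalues of the grading element are of the form `c - k`. -/
theorem eigenvalue_gradingElement (hγ : ∀ i j, γ i - γ j ≤ 1)
    (irr : ∀ V : Submodule ℂ (Fin d → ℂ), (∀ X : sl3, ∀ v ∈ V, D X *ᵥ v ∈ V) → V = ⊥ ∨ V = ⊤)
    {v : Fin d → ℂ} (hv : v ≠ 0) (hc : D (gradingElement γ) *ᵥ v = c • v)
    (h1 : ∀ X, HasDegree γ 1 X → D X *ᵥ v = 0) {w : Fin d → ℂ} (hw : w ≠ 0) {μ : ℂ}
    (hμ : D (gradingElement γ) *ᵥ w = μ • w) : ∃ k : ℕ, μ = c - k := by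
  have htop : (⨆ k, lowering D γ c k) = ⊤ := by
    refine (irr _ fun X v hv => iSup_lowering_invariant hγ X hv).resolve_left fun h => hv ?_
    have h0 : v ∈ lowering D γ c 0 := ⟨hc, h1⟩
    exact (Submodule.mem_bot ℂ).1 (h ▸ Submodule.mem_iSup_of_mem 0 h0)
  by_contra! hne
  -- The levels span the whole space and lie in eigenspaces for `c - k`; an eigenvector for any
  -- other value would contradict the independence of eigenspaces.
  have hind := (Module.End.eigenspaces_iSupIndep (D (gradingElement γ)).mulVecLin) μ
  refine hw (Submodule.disjoint_def.1 hind w (Module.End.mem_eigenspace_iff.2 hμ) ?_)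
  have hle : (⨆ k, lowering D γ c k) ≤
      ⨆ j, ⨆ (_ : j ≠ μ), Module.End.eigenspace (D (gradingElement γ)).mulVecLin j :=
    iSup_le fun k => (lowering_le_eigenspace k).trans
      (le_iSup₂_of_le (c - k) (hne k).symm le_rfl)
  exact hle (htop ▸ Submodule.mem_top)

end Rep

/-! ### The isomorphism class determines the highest weight -/

theorem trace_gradingElement_weight (γ : Fin 3 → ℤ) (a b : ℝ) :
    ((gradingElement γ).1 * (-Complex.I • weight a b)).trace =
      ((γ 0 * (2 * a + b) + γ 1 * (b - a) - γ 2 * (a + 2 * b)) / 3 : ℂ) := by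
  rw [weight_eq, smul_smul]
  have : -Complex.I * (Complex.I / 3) = 1 / 3 := by
    linear_combination (-1 / 3 : ℂ) * Complex.I_sq
  rw [this]
  simp [gradingElement, Matrix.trace_fin_three, Matrix.diagonal_mul, Fin.sum_univ_three]
  ring

/-- A nonzero intertwiner out of a quark system bounds the eigenvalues of a highest weight vector. -/
theorem QuarkSystem.exists_sub_natCast {ω ω' : Mat} (Q : QuarkSystem ω) (Q' : QuarkSystem ω')
    (φ : (Fin Q.dim → ℂ) →ₗ[ℂ] (Fin Q'.dim → ℂ)) (hφ : Function.Injective φ)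
    (hD : ∀ X v, φ (Q.dρ X *ᵥ v) = Q'.dρ X *ᵥ φ v) {γ : Fin 3 → ℤ}
    (hγ : ∀ i j, γ i - γ j ≤ 1) (hanti : Antitone γ) :
    ∃ k : ℕ, ((gradingElement γ).1 * (-Complex.I • ω)).trace =
      ((gradingElement γ).1 * (-Complex.I • ω')).trace - k := by
  obtain ⟨v, hv, -, hv2⟩ := Q.highest_weight
  obtain ⟨w, hw, hw1, hw2⟩ := Q'.highest_weight
  have hdiag : ∀ i j : Fin 3, i ≠ j → (gradingElement γ).1 i j = 0 := fun i j h =>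
    Matrix.diagonal_apply_ne _ h
  refine eigenvalue_gradingElement hγ Q'.irreducible hw (hw2 _ hdiag) (fun X hX => hw1 X ?_)
    (w := φ v) (fun h => hv (hφ (h.trans (map_zero φ).symm))) ?_
  -- As `γ` is antitone, degree 1 occurs only strictly above the diagonal, where matrices annihilate
  -- the highest weight vector.
  · intro i j hij
    refine hX i j ?_
    have := hanti hij
    omega
  · rw [← hD, hv2 _ hdiag, map_smul]

/-- Each of the two top eigenvalues of a grading element is the other minus a natural number, so
they coincide; two independent gradings then recover the weight. -/
theorem QuarkSystem.weight_eq_of_equiv {ω ω' : Mat} (Q : QuarkSystem ω) (Q' : QuarkSystem ω')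
    (hω : ∃ a b : ℝ, ω = weight a b) (hω' : ∃ a b : ℝ, ω' = weight a b)
    (φ : (Fin Q.dim → ℂ) ≃ₗ[ℂ] (Fin Q'.dim → ℂ))
    (hD : ∀ X v, φ (Q.dρ X *ᵥ v) = Q'.dρ X *ᵥ φ v) : ω = ω' := by
  have hD' : ∀ X v, φ.symm (Q'.dρ X *ᵥ v) = Q.dρ X *ᵥ φ.symm v := fun X v => by
    rw [LinearEquiv.symm_apply_eq, hD, LinearEquiv.apply_symm_apply]
  have key {γ : Fin 3 → ℤ} (hγ : ∀ i j, γ i - γ j ≤ 1) (hanti : Antitone γ) :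
      ((gradingElement γ).1 * (-Complex.I • ω)).trace =
        ((gradingElement γ).1 * (-Complex.I • ω')).trace := by
    obtain ⟨k, hk⟩ := Q.exists_sub_natCast Q' φ φ.injective hD hγ hanti
    obtain ⟨l, hl⟩ := Q'.exists_sub_natCast Q φ.symm φ.symm.injective hD' hγ hanti
    have h : ((k + l : ℕ) : ℂ) = 0 := by push_cast; linear_combination hk + hl
    have h : k + l = 0 := by exact_mod_cast h
    rw [hk, show k = 0 by omega, Nat.cast_zero, sub_zero]
  obtain ⟨a, b, rfl⟩ := hω
  obtain ⟨a', b', rfl⟩ := hω'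
  -- These gradings take the values `(2a + b) / 3` and `(a + 2b) / 3` on `weight a b`, which
  -- determine `a` and `b`.
  have h1 := key (γ := ![1, 0, 0]) (by decide) (by intro i j; revert i j; decide)
  have h2 := key (γ := ![1, 1, 0]) (by decide) (by intro i j; revert i j; decide)
  rw [trace_gradingElement_weight, trace_gradingElement_weight] at h1 h2
  simp at h1 h2
  have ha : (a : ℂ) = a' := by linear_combination (2 * h1 - h2) / 3
  have hb : (b : ℂ) = b' := by linear_combination (2 * h2 - h1) / 3
  rw [Complex.ofReal_injective ha, Complex.ofReal_injective hb]

/-! ### Integral radii and distinctness of the first weights -/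

theorem trace_conjTranspose_mul_weight (a b : ℝ) :
    ((weight a b)ᴴ * weight a b).trace = ((2 / 3 * (a ^ 2 + a * b + b ^ 2) : ℝ) : ℂ) := by
  rw [weight_eq]
  simp [Matrix.trace_fin_three, Matrix.mul_apply, Fin.sum_univ_three, Complex.conj_ofNat]
  have hI := Complex.I_sq
  generalize Complex.I = i at *
  grind

theorem smul_weight (r a b : ℝ) : (r : ℂ) • weight a b = weight (r * a) (r * b) := by
  simp only [weight, smul_add, smul_smul, Complex.ofReal_mul]

theorem ad_smul (g : SU3) (c : ℂ) (X : Mat) : Ad g (c • X) = c • Ad g X := by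
  simp [Ad]

theorem image_smul_orbit (c : ℂ) (X : Mat) : (fun v : Mat => c • v) '' orbit X = orbit (c • X) := by
  ext Y
  constructor
  · rintro ⟨_, ⟨g, rfl⟩, rfl⟩
    exact ⟨g, ad_smul g c X⟩
  · rintro ⟨g, rfl⟩
    exact ⟨Ad g X, ⟨g, rfl⟩, (ad_smul g c X).symm⟩

theorem mem_orbit_self (X : Mat) : X ∈ orbit X := ⟨1, by simp [Ad]⟩

theorem RatOrbit.pt_injective {ξ η : RatOrbit} (h : ξ.pt = η.pt) : ξ = η := by
  cases ξ; cases η; cases h; rfl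

/-- A positive multiple of the representative of a rational orbit is a dominant weight. -/
theorem RatOrbit.exists_dominant (ξ : RatOrbit) :
    ∃ α : ℝ, 0 < α ∧ IsDominantWeight ((α : ℂ) • ξ.pt) := by
  obtain ⟨ω, ⟨p, q, hω⟩, α, hα, h⟩ := ξ.rational
  obtain ⟨y, hy, hyω⟩ := h.symm ▸ mem_orbit_self ω
  have hα' : (α : ℂ) ≠ 0 := by exact_mod_cast hα.ne'
  have hyω : (α : ℂ) • y = ω := hyω
  have hyw : y = weight (α⁻¹ * p) (α⁻¹ * q) := by
    rw [← smul_weight, ← hω, ← hyω, smul_smul, Complex.ofReal_inv, inv_mul_cancel₀ hα', one_smul]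
  let η : RatOrbit :=
    { pt := y
      mem_Fbar := ⟨ξ.orb_subset hy, _, _, by positivity, by positivity, hyw⟩
      rational := ⟨ω, ⟨p, q, hω⟩, α, hα, by rw [image_smul_orbit, hyω]⟩ }
  -- The preimage `y` of the dominant weight is a chamber point of the same orbit; `tau` is constant
  -- on the orbit and separates chamber points, so `y` is the representative.
  have hξ : η = ξ := tau_injective (evalAt_tau_orbit ξ hy)
  exact ⟨α, hα, p, q, by rw [← hω, ← hyω, ← hξ]⟩

/-- A nonzero dominant weight has squared norm at least `2 / 3`, so all admissible radii exceed `1 /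
2`; since some radius is admissible, the infimum inherits this bound. -/
theorem intRadius_pos (ξ : RatOrbit) : 0 < intRadius ξ := by
  obtain ⟨α, hα⟩ := ξ.exists_dominant
  refine lt_of_lt_of_le (by norm_num : (0 : ℝ) < 1 / 2) (le_csInf ⟨α, hα⟩ ?_)
  rintro R ⟨hR, p, q, h⟩
  obtain ⟨⟨-, hS⟩, -⟩ := ξ.mem_Fbar
  have h1 := trace_conjTranspose_mul_weight p q
  rw [← h, Matrix.conjTranspose_smul, Matrix.smul_mul, Matrix.mul_smul, Matrix.trace_smul,
    Matrix.trace_smul, hS] at h1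
  have h2 : R * R = 2 / 3 * ((p : ℝ) ^ 2 + p * q + (q : ℝ) ^ 2) := by
    apply Complex.ofReal_injective
    rw [← h1]
    simp
  have h3 : p ^ 2 + p * q + q ^ 2 ≠ 0 := by
    intro h0
    have : ((p ^ 2 + p * q + q ^ 2 : ℕ) : ℝ) = 0 := by rw [h0]; simp
    push_cast at this
    rw [this] at h2
    nlinarith
  have h4 : (1 : ℝ) ≤ (p : ℝ) ^ 2 + p * q + (q : ℝ) ^ 2 := by
    exact_mod_cast Nat.one_le_iff_ne_zero.2 h3
  nlinarith

theorem firstWeight_eq_weight (ξ : RatOrbit) (s : ℕ) :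
    ∃ a b : ℝ, (s : ℂ) • firstWeight ξ = weight a b := by
  obtain ⟨-, a, b, -, -, h⟩ := ξ.mem_Fbar
  refine ⟨s * (intRadius ξ * a), s * (intRadius ξ * b), ?_⟩
  rw [firstWeight, h, smul_weight, ← Complex.ofReal_natCast, smul_weight]

/-- Different rational orbits have different first dominant weights, even up to scaling. -/
theorem firstWeight_smul_injective (s : ℕ+) {ξ η : RatOrbit}
    (h : ((s : ℕ) : ℂ) • firstWeight ξ = ((s : ℕ) : ℂ) • firstWeight η) : ξ = η := by
  have hs : ((s : ℕ) : ℂ) ≠ 0 := by exact_mod_cast s.ne_zero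
  have h := smul_right_injective Mat hs h
  -- Representatives are unit vectors, so the norm of the first weight is the radius. Equal weights
  -- have equal radii, which can then be cancelled.
  have norm (ξ : RatOrbit) : ((firstWeight ξ)ᴴ * firstWeight ξ).trace =
      ((intRadius ξ ^ 2 : ℝ) : ℂ) := by
    rw [firstWeight, Matrix.conjTranspose_smul, Matrix.smul_mul, Matrix.mul_smul,
      Matrix.trace_smul, Matrix.trace_smul, ξ.mem_Fbar.1.2]
    simp [sq]
  have hr : intRadius ξ = intRadius η := by
    have h2 := (norm ξ).symm.trans ((congrArg (fun X : Mat => (Xᴴ * X).trace) h).trans (norm η))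
    exact (sq_eq_sq₀ (intRadius_pos ξ).le (intRadius_pos η).le).1 (Complex.ofReal_injective h2)
  have hr0 : (intRadius η : ℂ) ≠ 0 := by exact_mod_cast (intRadius_pos η).ne'
  rw [firstWeight, firstWeight, hr] at h
  exact RatOrbit.pt_injective (smul_right_injective Mat hr0 h)

/-! ### Quark systems as simple modules over the enveloping algebra -/

/-- The space of a quark system, as a module over the universal enveloping algebra. -/
def QuarkSystem.Space {ω : Mat} (Q : QuarkSystem ω) : Type := Fin Q.dim → ℂ

namespace QuarkSystem

variable {ω : Mat} (Q : QuarkSystem ω)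

instance : AddCommGroup Q.Space := inferInstanceAs (AddCommGroup (Fin Q.dim → ℂ))

instance : Module ℂ Q.Space := inferInstanceAs (Module ℂ (Fin Q.dim → ℂ))

instance : FiniteDimensional ℂ Q.Space := inferInstanceAs (FiniteDimensional ℂ (Fin Q.dim → ℂ))

/-- The action depends on `Q` and not only on its dimension, which is why `Space` is a separate
type. -/
instance : Module Usl3 Q.Space :=
  Module.compHom (Fin Q.dim → ℂ) (Matrix.toLinAlgEquiv'.toAlgHom.comp Q.rep).toRingHom

theorem smul_eq (u : Usl3) (v : Q.Space) : u • v = (Q.rep u *ᵥ v : Fin Q.dim → ℂ) := rfl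

theorem rep_ι (X : sl3) : Q.rep (UniversalEnvelopingAlgebra.ι ℂ X) = Q.dρ X :=
  UniversalEnvelopingAlgebra.lift_ι_apply ℂ Q.dρ X

instance : IsScalarTower ℂ Usl3 Q.Space where
  smul_assoc c u v := by
    rw [smul_eq, smul_eq, map_smul]
    exact Matrix.smul_mulVec c (Q.rep u) v

instance : IsSimpleModule Usl3 Q.Space := by
  obtain ⟨v, hv, -⟩ := Q.highest_weight
  have : Nontrivial Q.Space := ⟨⟨v, (0 : Fin Q.dim → ℂ), hv⟩⟩
  refine { eq_bot_or_eq_top := fun N => ?_ }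
  -- A submodule over `Usl3` is in particular stable under the generators coming from `sl3`.
  have h := Q.irreducible (N.restrictScalars ℂ) fun X w hw => by
    rw [← rep_ι]
    exact N.smul_mem (UniversalEnvelopingAlgebra.ι ℂ X) hw
  exact h.imp (fun h => (Submodule.restrictScalars_eq_bot_iff ..).1 h)
    fun h => (Submodule.restrictScalars_eq_top_iff ..).1 h

/-- Quark systems of different weights have no nonzero intertwiners. -/
theorem intertwiner_eq_zero {ω' : Mat} (Q' : QuarkSystem ω') (hω : ∃ a b : ℝ, ω = weight a b)
    (hω' : ∃ a b : ℝ, ω' = weight a b) (hne : ω ≠ ω') (φ : Q.Space →ₗ[Usl3] Q'.Space) :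
    φ = 0 := by
  by_contra h
  -- Schur's lemma: a nonzero map between simple modules is an isomorphism, which would identify the
  -- weights.
  let e := LinearEquiv.ofBijective φ (LinearMap.bijective_of_ne_zero h)
  refine hne (Q.weight_eq_of_equiv Q' hω hω' (e.restrictScalars ℂ) fun X v => ?_)
  rw [← rep_ι, ← rep_ι]
  exact e.map_smul (UniversalEnvelopingAlgebra.ι ℂ X) v

end QuarkSystem

/-- Quark systems of pairwise different weights are jointly controlled by the universal enveloping
algebra: it maps onto the product of their operator algebras. -/
theorem exists_rep_eq {ι : Type*} [Finite ι] {ω : ι → Mat} (Q : ∀ i, QuarkSystem (ω i))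
    (hω : ∀ i, ∃ a b : ℝ, ω i = weight a b) (hinj : Function.Injective ω) (A : ∀ i, (Q i).Op) :
    ∃ u : Usl3, ∀ i, (Q i).rep u = A i := by
  have := Fintype.ofFinite ι
  obtain ⟨u, hu⟩ := exists_forall_smul_eq (k := ℂ) (R := Usl3) (fun i => (Q i).Space)
    (fun i j hij φ => (Q i).intertwiner_eq_zero (Q j) (hω i) (hω j) (hinj.ne hij) φ)
    (fun i => (A i).mulVecLin)
  exact ⟨u, fun i => Matrix.ext_of_mulVec_single fun j => hu i (Pi.single j (1 : ℂ))⟩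

/-! ### Glued correspondences, component by component -/

theorem PolyOver.ext {P : Finset RatOrbit} {x y : PolyOver P}
    (h : ∀ (ξ : RatOrbit) (hξ : ξ ∈ P), component hξ x = component hξ y) : x = y := by
  obtain ⟨f, rfl⟩ := Ideal.Quotient.mk_surjective x
  obtain ⟨g, rfl⟩ := Ideal.Quotient.mk_surjective y
  exact cls_eq h

/-- The sphere and the orbit are both `Ad`-invariant, so one pair of polynomial extensions computes
both brackets. -/
theorem toOrbit_poisson (ξ : RatOrbit) (f g : Poly S7) :
    toOrbit ξ (poisson f g) = poisson (toOrbit ξ f) (toOrbit ξ g) := by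
  obtain ⟨_, F, rfl⟩ := f
  obtain ⟨_, G, rfl⟩ := g
  have h1 := poisson_toPoly (S := S7) (fun _ h => h.1) (fun g _ h => ad_mem_S7 g h) F G
  have h2 := poisson_toPoly (S := ξ.orb) (fun _ h => (ξ.orb_subset h).1) (by
    rintro g _ ⟨g', rfl⟩
    exact ⟨g * g', by simp [Ad, Matrix.mul_assoc]⟩) F G
  exact (congrArg (toOrbit ξ) h1).trans h2.symm

section Glued

variable (R : ∀ ξ : RatOrbit, Ray ξ) {P : Finset RatOrbit} (s : ℕ+)

theorem component_mem_range {x : PolyOver P} (hx : x ∈ LinearMap.range (glued R P s))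
    {ξ : RatOrbit} (hξ : ξ ∈ P) : component hξ x ∈ LinearMap.range ((R ξ).w s) := by
  obtain ⟨u, rfl⟩ := hx
  exact ⟨u, (component_glued R s u hξ).symm⟩

/-- The image of the glued correspondence is the product of the images of the correspondences on
the orbits. -/
theorem mem_range_glued {x : PolyOver P}
    (hx : ∀ (ξ : RatOrbit) (hξ : ξ ∈ P), component hξ x ∈ LinearMap.range ((R ξ).w s)) :
    x ∈ LinearMap.range (glued R P s) := by
  choose u hu using hx
  choose Q W _ hw using fun ξ => (R ξ).universal s
  -- The preimages `u` vary with the orbit. Distinct weights allow a single `v` that acts as `u ξ`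
  -- in the representation attached to each `ξ`, and each correspondence sees only that action.
  obtain ⟨v, hv⟩ := exists_rep_eq (fun ξ : P => Q ξ) (fun ξ => firstWeight_eq_weight ξ s)
    (fun ξ η h => Subtype.ext (firstWeight_smul_injective s h)) fun ξ => (Q ξ).rep (u ξ ξ.2)
  refine ⟨v, PolyOver.ext fun ξ hξ => ?_⟩
  have h : (Q ξ).rep v = (Q ξ).rep (u ξ hξ) := hv ⟨ξ, hξ⟩
  rw [component_glued, ← hu ξ hξ, hw]
  simp [h]

/-- Both products are multiplication in `Usl3` transported to the image, and taking components turns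
the glued correspondence into that of the ray. Outside the image `twisted` has no such meaning,
hence the range hypotheses. -/
theorem component_twisted_glued {x y : PolyOver P}
    (hx : x ∈ LinearMap.range (glued R P s))
    (hy : y ∈ LinearMap.range (glued R P s)) {ξ : RatOrbit} (hξ : ξ ∈ P) :
    component hξ (twisted (glued R P s) x y) =
    twisted ((R ξ).w s) (component hξ x) (component hξ y) := by
  obtain ⟨u, rfl⟩ := hx
  obtain ⟨v, rfl⟩ := hy
  rw [twisted_glued, component_glued, component_glued, component_glued, Ray.twisted_apply]

theorem component_weightedBracket {x y : PolyOver P}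
    (hx : x ∈ LinearMap.range (glued R P s))
    (hy : y ∈ LinearMap.range (glued R P s)) {ξ : RatOrbit} (hξ : ξ ∈ P) :
    component hξ (weightedBracket R P s x y) =
    (intRadius ξ : ℂ) • twistedComm ((R ξ).w s) (component hξ x) (component hξ y) := by
  obtain ⟨u, rfl⟩ := hx
  obtain ⟨v, rfl⟩ := hy
  rw [weightedBracket_glued, component_sum (fun ξ => (intRadius ξ : ℂ) •
    twistedComm ((R ξ).w s) ((R ξ).w s u) ((R ξ).w s v)) hξ, component_glued, component_glued]

end Glued

/-! ### Reduction of the limits to single orbits -/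

theorem MagooSphere.limS_iff (𝔚 : MagooSphere) (n : ℕ+) (a : ℕ+ → 𝔚.Pn n) (L : 𝔚.Pn n) :
    𝔚.LimS n a L ↔ ∀ (ξ : RatOrbit) (hξ : ξ ∈ 𝔚.chain.P n),
      Tendsto (fun s => supNorm (component hξ (a s) - component hξ L)) atTop (𝓝 0) := by
  constructor
  · intro h ξ hξ
    refine ENNReal.tendsto_nhds_zero.2 fun ε hε => ?_
    obtain ⟨s₀, hs₀⟩ := h ε hε
    exact eventually_atTop.2 ⟨s₀, fun s hs => (hs₀ s hs ξ hξ).le⟩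
  · intro h ε hε
    have h1 : ∀ᶠ s in atTop, ∀ ξ : 𝔚.chain.P n,
        supNorm (component ξ.2 (a s) - component ξ.2 L) < ε :=
      -- Finiteness of the set in the chain supplies one threshold for all its orbits.
      eventually_all.2 fun ξ => (h ξ ξ.2).eventually (gt_mem_nhds hε)
    obtain ⟨s₀, hs₀⟩ := eventually_atTop.1 h1
    exact ⟨s₀, fun s hs ξ hξ => hs₀ s hs ⟨ξ, hξ⟩⟩

/-- `LimN` prescribes the components exactly at every `n`, so the inner limit can only be the class
of `f`, and no asymptotics in `n` remain. -/
theorem MagooSphere.iterLim_iff (𝔚 : MagooSphere) (a : ∀ n : ℕ+, ℕ+ → 𝔚.Pn n) (f : Poly S7) :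
    𝔚.IterLim a (fun ξ => toOrbit ξ f) ↔ ∀ (n : ℕ+) (ξ : RatOrbit) (hξ : ξ ∈ 𝔚.chain.P n),
      Tendsto (fun s => supNorm (component hξ (a n s) - toOrbit ξ f)) atTop (𝓝 0) := by
  constructor
  · rintro ⟨L, hL, hN⟩ n ξ hξ
    have h := (𝔚.limS_iff n _ _).1 (hL n) ξ hξ
    rwa [hN n ξ hξ] at h
  · intro h
    exact ⟨fun n => cls _ f, fun n => (𝔚.limS_iff n _ _).2 (h n), fun n ξ hξ => rfl⟩

/-- The reverse direction is where joint surjectivity enters, through `mem_range_glued`; a common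
threshold exists by finiteness. -/
theorem MagooSphere.eventually_mem_range_iff (𝔚 : MagooSphere) (n : ℕ+) (f : Poly S7) :
    (∀ᶠ s in atTop, cls (𝔚.chain.P n) f ∈ LinearMap.range (𝔚.w n s)) ↔
      ∀ ξ ∈ 𝔚.chain.P n, ∀ᶠ s in atTop, toOrbit ξ f ∈ LinearMap.range ((𝔚.ray ξ).w s) := by
  constructor
  · intro h ξ hξ
    filter_upwards [h] with s hs
    exact component_mem_range 𝔚.ray s hs hξ
  · intro h
    have h1 : ∀ᶠ s in atTop, ∀ ξ : 𝔚.chain.P n,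
        toOrbit ξ f ∈ LinearMap.range ((𝔚.ray ξ).w s) := eventually_all.2 fun ξ => h ξ ξ.2
    filter_upwards [h1] with s hs
    exact mem_range_glued 𝔚.ray s fun ξ hξ => hs ⟨ξ, hξ⟩

/-- Once the images contain `f` and `g`, the limits defining the Poisson type of a Magoo sphere are
those of its rays, orbit by orbit. -/
theorem MagooSphere.limits_iff (𝔚 : MagooSphere) {f g : Poly S7}
    (hf : ∀ n, ∀ᶠ s in atTop, cls (𝔚.chain.P n) f ∈ LinearMap.range (𝔚.w n s))
    (hg : ∀ n, ∀ᶠ s in atTop, cls (𝔚.chain.P n) g ∈ LinearMap.range (𝔚.w n s)) :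
    (𝔚.IterLim (fun n s => 𝔚.prod n s (cls _ f) (cls _ g)) (fun ξ => toOrbit ξ (f * g)) ↔
      ∀ (n : ℕ+), ∀ ξ ∈ 𝔚.chain.P n, Tendsto (fun s => supNorm
        (twisted ((𝔚.ray ξ).w s) (toOrbit ξ f) (toOrbit ξ g) - toOrbit ξ f * toOrbit ξ g))
        atTop (𝓝 0)) ∧
    (𝔚.IterLim (fun n s => ((s : ℕ) : ℂ) • 𝔚.brack n s (cls _ f) (cls _ g))
        (fun ξ => toOrbit ξ (Complex.I • poisson f g)) ↔
      ∀ (n : ℕ+), ∀ ξ ∈ 𝔚.chain.P n, Tendsto (fun s : ℕ+ => supNorm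
        ((((s : ℕ) : ℂ) * (intRadius ξ : ℂ)) •
          twistedComm ((𝔚.ray ξ).w s) (toOrbit ξ f) (toOrbit ξ g) -
          Complex.I • poisson (toOrbit ξ f) (toOrbit ξ g))) atTop (𝓝 0)) := by
  rw [𝔚.iterLim_iff, 𝔚.iterLim_iff]
  constructor
  · refine forall_congr' fun n => forall_congr' fun ξ => forall_congr' fun hξ => ?_
    refine tendsto_congr' ?_
    -- The two expressions are shown equal only once both classes lie in the image, that is for
    -- large `s`, which suffices for the limit.
    filter_upwards [hf n, hg n] with s hs1 hs2
    rw [MagooSphere.prod, MagooSphere.w, component_twisted_glued 𝔚.ray s hs1 hs2 hξ, map_mul,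
      component_cls, component_cls]
  · refine forall_congr' fun n => forall_congr' fun ξ => forall_congr' fun hξ => ?_
    refine tendsto_congr' ?_
    filter_upwards [hf n, hg n] with s hs1 hs2
    rw [MagooSphere.brack, map_smul, component_weightedBracket 𝔚.ray s hs1 hs2 hξ, map_smul,
      component_cls, component_cls, smul_smul, toOrbit_poisson]

theorem MagooSphere.isPoisson_iff (𝔚 : MagooSphere) :
    𝔚.IsPoisson ↔ ∀ ξ : RatOrbit, (𝔚.ray ξ).IsPoisson := by
  constructor
  · intro h ξ f₁ f₂
    obtain ⟨F₁, rfl⟩ := toOrbit_surjective ξ f₁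
    obtain ⟨F₂, rfl⟩ := toOrbit_surjective ξ f₂
    -- Any stage of the chain containing `ξ` serves; this is the only use of the chain.
    obtain ⟨n, hn⟩ := 𝔚.chain.exhausts ξ
    obtain ⟨hr, hp, hb⟩ := h F₁ F₂
    have hF₁ := fun n => (hr n).mono fun _ h => h.1
    have hF₂ := fun n => (hr n).mono fun _ h => h.2
    obtain ⟨h1, h2⟩ := 𝔚.limits_iff hF₁ hF₂
    exact ⟨((𝔚.eventually_mem_range_iff n F₁).1 (hF₁ n) ξ hn).and
      ((𝔚.eventually_mem_range_iff n F₂).1 (hF₂ n) ξ hn), h1.1 hp n ξ hn, h2.1 hb n ξ hn⟩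
  · intro h F₁ F₂
    have hF₁ := fun n => (𝔚.eventually_mem_range_iff n F₁).2 fun ξ _ =>
      (h ξ (toOrbit ξ F₁) (toOrbit ξ F₂)).1.mono fun _ h => h.1
    have hF₂ := fun n => (𝔚.eventually_mem_range_iff n F₂).2 fun ξ _ =>
      (h ξ (toOrbit ξ F₁) (toOrbit ξ F₂)).1.mono fun _ h => h.2
    obtain ⟨h1, h2⟩ := 𝔚.limits_iff hF₁ hF₂
    exact ⟨fun n => (hF₁ n).and (hF₂ n), h1.2 fun n ξ _ => (h ξ _ _).2.1,
      h2.2 fun n ξ _ => (h ξ _ _).2.2⟩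

end

end Magoo

theorem theorem4p13 :
    (∀ 𝔚 : Magoo.MagooSphere, 𝔚.IsPoisson ↔ ∀ ξ : Magoo.RatOrbit, (𝔚.ray ξ).IsPoisson) ∧
    (∀ 𝔚₁ 𝔚₂ : Magoo.MagooSphere, 𝔚₁.ray = 𝔚₂.ray → (𝔚₁.IsPoisson ↔ 𝔚₂.IsPoisson)) := by
  -- The criterion mentions only the rays, which makes the chain irrelevant.
  refine ⟨fun 𝔚 => 𝔚.isPoisson_iff, fun 𝔚₁ 𝔚₂ h => ?_⟩
  rw [𝔚₁.isPoisson_iff, 𝔚₂.isPoisson_iff, h]
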